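/- Let $\mathfrak{g}_{\mathrm{af}}$ be a twisted affine Lie algebra of dual untwisted type ($D_{\ell+1}^{(2)}$, $A_{2\ell-1}^{(2)}$, $E_6^{(2)}$ or $D_4^{(3)}$), and let $\mathfrak{g}$ be its finite-dimensional simple subalgebra obtained by deleting the affine node, with index set $I$, roots $\Delta$, Weyl group $W$, length function $\ell$ and root lattice $Q$. The real affine roots are $\gamma+nc_\gamma\delta$ ($\gamma\in\Delta$, $n\in\mathbb{Z}$; $c_\gamma=(\gamma,\gamma)/2$ with short roots of square length $2$), with coroots $\gamma^\vee+nK$, and they are positive if $n>0$, or $n=0$ and $\gamma\in\Delta^+$. The affine Weyl group is $W_{\mathrm{af}}=W\ltimes\{t_\xi:\xi\in Q\}$. For $J\subset I$ let $\Delta_J$ and $W_J$ be the corresponding parabolic root subsystem and subgroup, $W^J$ the minimal-length representatives of $W/W_J$, $\lfloor w\rfloor^J$ the one in $wW_J$, $\rho_J^\vee=\frac12\sum_{\alpha\in\Delta_J^+}\alpha^\vee$ and $\rho^\vee=\rho_I^\vee$. Let $(W^J)_{\mathrm{af}}$ be the set of $x\in W_{\mathrm{af}}$ such that $x\beta$ is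 positive for every positive real affine root $\beta=\gamma+nc_\gamma\delta$ with $\gamma\in\Delta_J$, and let $Q^{J\text{-ad}}$ be the set of $\xi\in Q$ with $\langle\gamma^\vee,\xi\rangle\in\{0,-1\}$ for all $\gamma\in\Delta_J^+$. For $\xi\in Q^{J\text{-ad}}$ let $z_\xi\in W_J$ be the element with $z_\xi t_\xi\in(W^J)_{\mathrm{af}}$. The quantum Bruhat graph $\mathrm{QBG}^J$ has vertex set $W^J$ and edges $w\xrightarrow{\gamma}v$ for $\gamma\in\Delta^+\setminus\Delta_J^+$ and $v=\lfloor ws_\gamma\rfloor^J$ with $\ell(v)=\ell(w)+1$ or $\ell(v)=\ell(w)-2\langle\rho^\vee-\rho_J^\vee,\gamma\rangle+1$. The semi-infinite Bruhat graph $\frac{\infty}{2}\mathrm{BG}^J$ has vertex set $(W^J)_{\mathrm{af}}$ and edges $x\xrightarrow{\beta}s_\beta x$ for positive real affine roots $\beta$ with $\ell^{\infty/2}(s_\beta x)=\ell^{\infty/2}(x)+1$, where $\ell^{\infty/2}(wt_\xi)=\ell(w)+2\langle\rho^\vee,\xi\rangle$. Let $\lambda$ be a level-zero dominant integral weight, that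 is, a sum of non-negative integer multiples of the level-zero fundamental weights $\varpi_i$ ($i\in I$) and an integer multiple of $\delta$; let $\mathrm{cl}(\lambda)$ be its restriction to the Cartan subalgebra of $\mathfrak{g}$, and put $J_\lambda=\{i\in I:\langle\alpha_i^\vee,\lambda\rangle=0\}$. For rational $a\in(0,1]$, an $a$-chain of shape $\mathrm{cl}(\lambda)$ is a directed path in $\mathrm{QBG}^{J_\lambda}$ with $a\langle\gamma^\vee,\mathrm{cl}(\lambda)\rangle\in\mathbb{Z}$ for every edge label $\gamma$, and an $a$-chain of shape $\lambda$ is a directed path in $\frac{\infty}{2}\mathrm{BG}^{J_\lambda}$ with $a\langle\beta^\vee,x\lambda\rangle\in\mathbb{Z}$ for every edge $x\xrightarrow{\beta}s_\beta x$. A QLS path of shape $\mathrm{cl}(\lambda)$ (respectively, a semi-infinite LS path of shape $\lambda$) is a sequence $(x_1,\dots,x_s;a_0,\dots,a_s)$ with $s\ge1$, $x_m\in W^{J_\lambda}$ (respectively, $x_m\in(W^{J_\lambda})_{\mathrm{af}}$), rational numbers $0=a_0<a_1<\dots<a_s=1$, and, for $1\le m\le s-1$, $x_m\ne x_{m+1}$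 and an $a_m$-chain of shape $\mathrm{cl}(\lambda)$ (respectively, $\lambda$) from $x_{m+1}$ to $x_m$. Then every $x\in(W^{J_\lambda})_{\mathrm{af}}$ can be written as $x=wz_\xi t_\xi$ with $w\in W^{J_\lambda}$ and $\xi\in Q^{J_\lambda\text{-ad}}$, with $(w,\xi)$ unique, and there is a well-defined map from the set of semi-infinite LS paths of shape $\lambda$ to the set of QLS paths of shape $\mathrm{cl}(\lambda)$, given by $$(x_1,\dots,x_s;a_0,\dots,a_s)\mapsto(w_1,\dots,w_s;a_0,\dots,a_s),\qquad x_m=w_mz_{\xi_m}t_{\xi_m},\ w_m\in W^{J_\lambda},\ \xi_m\in Q^{J_\lambda\text{-ad}},$$ where on the right, for each $m$ with $w_m=w_{m+1}$, the entries $w_m$ and $a_m$ are deleted. This map is surjective; moreover, every QLS path $(w_1,\dots,w_s;a_0,\dots,a_s)$ of shape $\mathrm{cl}(\lambda)$ is the image of some semi-infinite LS path $(x_1,\dots,x_s;a_0,\dots,a_s)$ with the same $s$ and the same $a_m$, so that no deletion occurs. -/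

import Mathlib

namespace DualUntwisted

noncomputable section

/-!
The finite-dimensional simple Lie algebra `𝔤` is given by its root system `P` (on the real forms
`V` of `𝔥^*` and `N` of `𝔥`) together with a base `b`, whose support is the index set `I`.

From it the twisted affine root system of dual untwisted type is built in the realization
`𝔥_af^* = V ⊕ ℝ δ ⊕ ℝ Λ₀`, `𝔥_af = N ⊕ ℝ K ⊕ ℝ d`: its simple roots are those of `𝔤` and
`α₀ = δ - θ` with `θ` the highest short root, and its simple coroots are those of `𝔤` and
`α₀^∨ = K - θ^∨`. For `P` of type `B_ℓ`, `C_ℓ`, `F₄`, `G₂` the affine type is `D_{ℓ+1}^{(2)}`,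
`A_{2ℓ-1}^{(2)}`, `E₆^{(2)}`, `D₄^{(3)}`, respectively.
-/

/-- `𝔥_af^*`; the triple `(v, a, l)` is `v + a δ + l Λ₀`. -/
abbrev AffWt (V : Type*) := V × ℝ × ℝ

/-- `𝔥_af`; the triple `(h, k, e)` is `h + k K + e d`. -/
abbrev AffCowt (N : Type*) := N × ℝ × ℝ

section Affine

variable {ι V N : Type*} [Fintype ι] [AddCommGroup V] [Module ℝ V] [AddCommGroup N] [Module ℝ N]
  (P : RootPairing ι ℝ V N)

set_option linter.unusedSectionVars false

/-- The canonical pairing `⟨h, μ⟩` of `𝔥_af` and `𝔥_af^*`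
(`⟨K, Λ₀⟩ = ⟨d, δ⟩ = 1`, `⟨K, δ⟩ = ⟨d, Λ₀⟩ = 0`). -/
def affPairing : AffWt V →ₗ[ℝ] AffCowt N →ₗ[ℝ] ℝ :=
  LinearMap.mk₂ ℝ (fun μ h => P.toLinearMap μ.1 h.1 + μ.2.1 * h.2.2 + μ.2.2 * h.2.1)
    (by intros; simp; ring) (by intros; simp; ring) (by intros; simp; ring) (by intros; simp; ring)

theorem affPairing_apply (μ : AffWt V) (h : AffCowt N) :
    affPairing P μ h = P.toLinearMap μ.1 h.1 + μ.2.1 * h.2.2 + μ.2.2 * h.2.1 := rfl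

/-- The invariant bilinear form `(x | y)` on `V`, normalized so that short roots have
square length `2`. -/
def form (x y : V) : ℝ :=
  2 / (⨅ i, P.RootForm (P.root i) (P.root i)) * P.RootForm x y

/-- `c_γ = (γ | γ) / 2`: it is `1` for a short root and `r` for a long root, where `r ∈ {2, 3}` is
the order of the twist. -/
def c (i : ι) : ℝ := form P (P.root i) (P.root i) / 2

/-- The real affine root `γ + n c_γ δ`. The set `Δ_af` of real roots of the affine Lie algebra of
dual untwisted type consists of these for `γ ∈ Δ` and `n ∈ ℤ`. -/
def affRoot (i : ι) (n : ℤ) : AffWt V := (P.root i, n * c P i, 0)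

/-- The coroot `γ^∨ + n K` of the real affine root `γ + n c_γ δ`. -/
def affCoroot (i : ι) (n : ℤ) : AffCowt N := (P.coroot i, n, 0)

theorem affPairing_self (i : ι) (n : ℤ) :
    (affPairing P).flip (affCoroot P i n) (affRoot P i n) = 2 := by
  simp [affPairing_apply, affRoot, affCoroot]

/-- The reflection `s_β` of `𝔥_af^*` for `β = γ + n c_γ δ`. -/
def s (i : ι) (n : ℤ) : AffWt V ≃ₗ[ℝ] AffWt V :=
  Module.reflection (affPairing_self P i n)

/-- The affine Weyl group, generated by the reflections in the real roots. -/
def Waf : Subgroup (AffWt V ≃ₗ[ℝ] AffWt V) :=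
  Subgroup.closure {g | ∃ i n, g = s P i n}

/-- The finite Weyl group, acting on `𝔥_af^*`. -/
def W : Subgroup (AffWt V ≃ₗ[ℝ] AffWt V) :=
  Subgroup.closure {g | ∃ i, g = s P i 0}

/-- The underlying map of the translation `t_ξ`:
`μ ↦ μ + ⟨K, μ⟩ ξ - ((μ | ξ) + ½ (ξ | ξ) ⟨K, μ⟩) δ`. -/
def tFun (ξ : V) (μ : AffWt V) : AffWt V :=
  (μ.1 + μ.2.2 • ξ, μ.2.1 - (form P μ.1 ξ + form P ξ ξ / 2 * μ.2.2), μ.2.2)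

theorem tFun_neg_tFun (ξ : V) (μ : AffWt V) : tFun P (-ξ) (tFun P ξ μ) = μ := by
  refine Prod.ext ?_ (Prod.ext ?_ ?_) <;> simp [tFun, form]
  ring

/-- The translation `t_ξ`, a linear automorphism of `𝔥_af^*`. -/
def t (ξ : V) : AffWt V ≃ₗ[ℝ] AffWt V where
  toFun := tFun P ξ
  invFun := tFun P (-ξ)
  left_inv := tFun_neg_tFun P ξ
  right_inv μ := by simpa using tFun_neg_tFun P (-ξ) μ
  map_add' x y := by
    refine Prod.ext ?_ (Prod.ext ?_ ?_) <;> simp [tFun, form, add_smul]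
    · abel
    · ring
  map_smul' r x := by
    refine Prod.ext ?_ (Prod.ext ?_ ?_) <;> simp [tFun, form, mul_smul]
    ring

/-- The root lattice `Q` of `𝔤`. -/
def Q : AddSubgroup V := AddSubgroup.closure (Set.range P.root)

/-- The root with index `i` lies in `Δ_J`. -/
def InJ (J : Set ι) (i : ι) : Prop := P.root i ∈ AddSubgroup.closure (P.root '' J)

/-- The parabolic subgroup `W_J`, generated by the simple reflections `s_j`, `j ∈ J`. -/
def WJ (J : Set ι) : Subgroup (AffWt V ≃ₗ[ℝ] AffWt V) :=
  Subgroup.closure {g | ∃ j ∈ J, g = s P j 0}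

variable {P} (b : P.Base)

/-- The affine root `γ + n c_γ δ` is positive. -/
def AffPos (i : ι) (n : ℤ) : Prop := 0 < n ∨ (n = 0 ∧ b.IsPos i)

/-- The length function of the finite Weyl group: the least length of a word in the simple
reflections. -/
def len (w : AffWt V ≃ₗ[ℝ] AffWt V) : ℕ :=
  sInf {k | ∃ l : List ι, l.length = k ∧ (∀ i ∈ l, i ∈ b.support) ∧
    w = (l.map fun i => s P i 0).prod}

/-- The set `W^J` of minimal-length representatives of the cosets in `W / W_J`. -/
def WUp (J : Set ι) : Set (AffWt V ≃ₗ[ℝ] AffWt V) :=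
  {w | w ∈ W P ∧ ∀ u ∈ WJ P J, len b w ≤ len b (w * u)}

/-- `v = ⌊w⌋^J`: the element `v` is the minimal-length representative of `w W_J`. -/
def IsFloor (J : Set ι) (w v : AffWt V ≃ₗ[ℝ] AffWt V) : Prop :=
  v ∈ WUp b J ∧ ∃ u ∈ WJ P J, w = v * u

open Classical in
/-- `ρ_J^∨`, half the sum of the coroots of the positive roots in `Δ_J`. -/
def rhoCheck (J : Set ι) : N :=
  (1 / 2 : ℝ) • ∑ i with b.IsPos i ∧ InJ P J i, P.coroot i

/-- `ρ^∨`, half the sum of the positive coroots. -/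
def rho : N := rhoCheck b (b.support : Set ι)

/-! ### The quantum Bruhat graph and quantum LS paths -/

/-- There is an edge `w → v` with label `γ` in the parabolic quantum Bruhat graph `QBG^J`. -/
def QEdge (J : Set ι) (γ : ι) (w v : AffWt V ≃ₗ[ℝ] AffWt V) : Prop :=
  w ∈ WUp b J ∧ v ∈ WUp b J ∧ b.IsPos γ ∧ ¬ InJ P J γ ∧ IsFloor b J (w * s P γ 0) v ∧
    ((len b v : ℝ) = len b w + 1 ∨
      (len b v : ℝ) = len b w - 2 * P.toLinearMap (P.root γ) (rho b - rhoCheck b J) + 1)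

/-- `J_λ` for `λ ∈ P⁺`. -/
def J (lam : V) : Set ι := {i | i ∈ b.support ∧ P.toLinearMap lam (P.coroot i) = 0}

/-- There is an `a`-chain of shape `λ` from `w` to `v` in `QBG^{J_λ}`. -/
def QChain (lam : V) (a : ℚ) : (w v : AffWt V ≃ₗ[ℝ] AffWt V) → Prop :=
  Relation.ReflTransGen fun x y => ∃ γ, QEdge b (J b lam) γ x y ∧
    ∃ k : ℤ, (a : ℝ) * P.toLinearMap lam (P.coroot γ) = k

/-! ### The semi-infinite Bruhat graph and semi-infinite LS paths -/

/-- Peterson's coset representatives `(W^J)_af`: the `x ∈ W_af` with `x β ∈ Δ_af^+` for all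
`β ∈ (Δ_J)_af^+`, that is, for all positive `β = γ + n c_γ δ` with `γ ∈ Δ_J`. -/
def Pet (J : Set ι) : Set (AffWt V ≃ₗ[ℝ] AffWt V) :=
  {x | x ∈ Waf P ∧ ∀ i n, InJ P J i → AffPos b i n →
    ∃ j m, AffPos b j m ∧ x (affRoot P i n) = affRoot P j m}

/-- The semi-infinite length of `x = w t_ξ` is `m = ℓ(w) + 2 ⟨ρ^∨, ξ⟩`. -/
def IsSiLen (x : AffWt V ≃ₗ[ℝ] AffWt V) (m : ℝ) : Prop :=
  ∃ w ∈ W P, ∃ ξ ∈ Q P, x = w * t P ξ ∧ m = len b w + 2 * P.toLinearMap ξ (rho b)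

/-- There is an edge `x → y` with label `β = γ + n c_γ δ ∈ Δ_af^+` in the parabolic semi-infinite
Bruhat graph with vertex set `(W^J)_af`. -/
def SiEdge (J : Set ι) (γ : ι) (n : ℤ) (x y : AffWt V ≃ₗ[ℝ] AffWt V) : Prop :=
  x ∈ Pet b J ∧ y ∈ Pet b J ∧ AffPos b γ n ∧ y = s P γ n * x ∧
    ∃ m, IsSiLen b x m ∧ IsSiLen b y (m + 1)

/-- `J_λ` for `λ ∈ P⁰₊`. -/
def Jaf (lam : AffWt V) : Set ι :=
  {i | i ∈ b.support ∧ affPairing P lam (affCoroot P i 0) = 0}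

/-- There is an `a`-chain of shape `λ` from `x` to `y` in the semi-infinite Bruhat graph: a directed
path whose edges `x' → s_β x'` satisfy `a ⟨β^∨, x' λ⟩ ∈ ℤ`. -/
def SiChain (lam : AffWt V) (a : ℚ) : (x y : AffWt V ≃ₗ[ℝ] AffWt V) → Prop :=
  Relation.ReflTransGen fun x' y' => ∃ γ n, SiEdge b (Jaf b lam) γ n x' y' ∧
    ∃ k : ℤ, (a : ℝ) * affPairing P (x' lam) (affCoroot P γ n) = k

/-- The level-zero dominant integral weights `P⁰₊`: the sums of nonnegative integer multiples of the
level-zero fundamental weights and an integer multiple of `δ`. -/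
def P0plus : Set (AffWt V) :=
  {lam | affPairing P lam (0, 1, 0) = 0 ∧ (∃ k : ℤ, affPairing P lam (0, 0, 1) = k) ∧
    ∀ i ∈ b.support, ∃ k : ℕ, affPairing P lam (affCoroot P i 0) = k}

/-- The restriction of weights to `𝔥`. -/
def cl (lam : AffWt V) : V := lam.1

/-- The `J`-adjusted elements of `Q`. -/
def Adjusted (J : Set ι) : Set V :=
  {ξ | ξ ∈ Q P ∧ ∀ i, b.IsPos i → InJ P J i →
    P.toLinearMap ξ (P.coroot i) = 0 ∨ P.toLinearMap ξ (P.coroot i) = -1}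

/-- `z = z_ξ`: the element `z ∈ W_J` with `z t_ξ ∈ (W^J)_af`. -/
def IsZ (J : Set ι) (ξ : V) (z : AffWt V ≃ₗ[ℝ] AffWt V) : Prop :=
  z ∈ WJ P J ∧ z * t P ξ ∈ Pet b J

/-- `x = w z_ξ t_ξ` with `w ∈ W^J` and `ξ` a `J`-adjusted element of `Q`. -/
def IsDecomp (J : Set ι) (x w : AffWt V ≃ₗ[ℝ] AffWt V) (ξ : V) : Prop :=
  w ∈ WUp b J ∧ ξ ∈ Adjusted b J ∧ ∃ z, IsZ b J ξ z ∧ x = w * z * t P ξ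

end Affine

/-- A path `(x₁, …, x_s; 0 = a₀ < a₁ < … < a_s = 1)` is written as the list
`[(x₁, a₁), …, (x_s, a_s)]`. The entries have to lie in `S`, consecutive entries have to be
distinct, and `C a_m x_{m+1} x_m` has to hold for `1 ≤ m ≤ s - 1`. -/
def IsLSPath {X : Type*} (S : Set X) (C : ℚ → X → X → Prop) (η : List (X × ℚ)) : Prop :=
  (∃ x, η.getLast? = some (x, 1)) ∧ (∀ p ∈ η, p.1 ∈ S ∧ 0 < p.2 ∧ p.2 ≤ 1) ∧
    η.IsChain fun p q => p.2 < q.2 ∧ p.1 ≠ q.1 ∧ C p.2 q.1 p.1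

open Classical in
/-- Delete `x_m` and `a_m` from `(x₁, …, x_s; a₀, …, a_s)` for each `m` with `x_m = x_{m+1}`. -/
def merge {X : Type*} : List (X × ℚ) → List (X × ℚ)
  | [] => []
  | [p] => [p]
  | p :: q :: l => if p.1 = q.1 then merge (q :: l) else p :: merge (q :: l)

section Paths

variable {ι V N : Type*} [Fintype ι] [AddCommGroup V] [Module ℝ V] [AddCommGroup N] [Module ℝ N]
  {P : RootPairing ι ℝ V N} (b : P.Base)

/-- The set of quantum LS paths of shape `λ`. -/
def QLS (lam : V) : Set (List ((AffWt V ≃ₗ[ℝ] AffWt V) × ℚ)) :=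
  {η | IsLSPath (WUp b (J b lam)) (QChain b lam) η}

/-- The set of semi-infinite LS paths of shape `λ`. -/
def SiLS (lam : AffWt V) : Set (List ((AffWt V ≃ₗ[ℝ] AffWt V) × ℚ)) :=
  {η | IsLSPath (Pet b (Jaf b lam)) (SiChain b lam) η}

/-- `η = (x₁, …, x_s; a₀, …, a_s)` and `ζ = (w₁, …, w_s; a₀, …, a_s)`, where `x_m = w_m z_{ξ_m} t_{ξ_m}`
with `w_m ∈ W^{J_λ}` and `ξ_m` a `J_λ`-adjusted element of `Q`. -/
def Forgets (lam : AffWt V) (η ζ : List ((AffWt V ≃ₗ[ℝ] AffWt V) × ℚ)) : Prop :=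
  List.Forall₂ (fun p q => (∃ ξ, IsDecomp b (Jaf b lam) p.1 q.1 ξ) ∧ p.2 = q.2) η ζ

end Paths

end

end DualUntwisted

namespace DualUntwisted

noncomputable section

open RootPairing

/-! ### Finite root system: automorphisms, heights relative to `J`, signs of roots. -/

section Finite

variable {ι V N : Type*} [AddCommGroup V] [Module ℝ V] [AddCommGroup N] [Module ℝ N]
  {P : RootPairing ι ℝ V N}

/-! Write a vertex as `x = g t_ξ` and the label of an edge out of it as `β = gγ + n c_γ δ`. Then
`s_β x = (g s_γ) t_{ξ + nγ}`, so every condition on the edge becomes a condition on `g`, `γ`, `n`.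
Let `I(g)` (`invCount`) be the number of roots in `Δ⁺ \ Δ_J⁺` that `g` makes negative. On `(W^J)_af`
the contribution of `Δ_J` to `ℓ(g)` cancels against `2⟨ρ_J^∨, ξ⟩`, so the semi-infinite length is
`I(g) + 2⟨ρ^∨ - ρ_J^∨, ξ⟩` (`isSiLen_iff`). An edge therefore means `D + nR = 1` with `D = I(g s_γ)
- I(g)` and `R = 2⟨ρ^∨ - ρ_J^∨, γ⟩` (`siEdge_iff`).

Both `D` and `R` are sums over the roots that `s_γ` moves out of `Δ⁺ \ Δ_J⁺`. For `γ` in `Δ⁺ \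
Δ_J⁺`, comparing them term by term gives `D ≥ 1 - R` and `R ≥ 2`. As `n ≥ 0`, either `n = 0` and `D
= 1`, or `n = 1` and `D = 1 - R` (`bruhat_or_quantum`). Since `I` is invariant under right
multiplication by `W_J` and equals the length on `W^J`, these are exactly the Bruhat and quantum
edges of `QBG^J`.

Conversely, when `D = 1` or `D = 1 - R` the termwise bounds are attained, which determines the sign
changes so precisely that `(g s_γ) t_{ξ + nγ}` lies again in `(W^J)_af` (`exists_petCond_of_edge`).
So an edge of `QBG^J` lifts from any prescribed lift of its source.

As `λ` has level zero and is fixed by `W_J`, `⟨β^∨, xλ⟩ = ⟨γ^∨, λ⟩`, and the integrality conditions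
on the two sides agree. Hence `a`-chains project (`exists_qEdge_of_siEdge`) and lift
(`exists_siEdge_of_qEdge`), and a QLS path is lifted entry by entry, starting from its last entry.
-/

theorem root_smul (g : P.Aut) (i : ι) : P.root (g • i) = g • P.root i :=
  RootPairing.Equiv.root_indexEquiv_eq_smul P i g

theorem reflection_smul_index (i j : ι) : Equiv.reflection P i • j = P.reflectionPerm i j := rfl

theorem toLinearMap_smul_coroot (g : P.Aut) (v : V) (i : ι) :
    P.toLinearMap (g • v) (P.coroot (g • i)) = P.toLinearMap v (P.coroot i) := by
  have h := Hom.weight_coweight_transpose_apply P P (P.coroot (g • i)) g.toHom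
  rw [Hom.coroot_coweightMap_apply] at h
  have h2 := LinearMap.congr_fun h v
  have h3 : (g.toHom.indexEquiv.symm (g • i)) = i := g.toHom.indexEquiv.symm_apply_apply i
  rw [h3] at h2
  exact h2

theorem pairing_smul_smul (g : P.Aut) (i j : ι) : P.pairing (g • i) (g • j) = P.pairing i j := by
  rw [← root_coroot_eq_pairing, root_smul, toLinearMap_smul_coroot, root_coroot_eq_pairing]

theorem smul_smul_real (g : P.Aut) (r : ℝ) (v : V) : g • (r • v) = r • (g • v) := smul_comm g r v

theorem aut_ext {g h : P.Aut} (H : ∀ v : V, g • v = h • v) : g = h :=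
  Equiv.weightHom_injective P (LinearEquiv.ext H)

theorem conj_reflection (g : P.Aut) (i : ι) :
    g * Equiv.reflection P i * g⁻¹ = Equiv.reflection P (g • i) := by
  refine aut_ext fun v => ?_
  have h := toLinearMap_smul_coroot g (g⁻¹ • v) i
  rw [smul_inv_smul] at h
  rw [mul_smul, mul_smul, Equiv.reflection_smul, Equiv.reflection_smul, reflection_apply,
    reflection_apply, smul_sub, smul_inv_smul, smul_smul_real, root_smul]
  change v - P.toLinearMap (g⁻¹ • v) (P.coroot i) • _ = v - P.toLinearMap v (P.coroot (g • i)) • _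
  rw [h]

theorem reflection_mul_self (i : ι) : Equiv.reflection P i * Equiv.reflection P i = 1 := by
  nth_rw 1 [← Equiv.reflection_inv P i]
  exact inv_mul_cancel _

theorem mul_reflection (g : P.Aut) (i : ι) :
    g * Equiv.reflection P i = Equiv.reflection P (g • i) * g := by
  rw [← conj_reflection]; group

variable (b : P.Base)

theorem isPos_reflectionPerm_self (i : ι) : b.IsPos (P.reflectionPerm i i) ↔ ¬ b.IsPos i :=
  Base.IsPos.neg_iff_not b i

theorem root_reflectionPerm_self (i : ι) : P.root (P.reflectionPerm i i) = -P.root i := by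
  rw [root_reflectionPerm, reflection_apply_self]

/-- The linear functional on `V` that is `0` on `α_j` for `j ∈ J` and `1` on the other simple
roots. -/
def offHeight [P.IsRootSystem] (J : Set ι) : V →ₗ[ℝ] ℝ :=
  open Classical in b.toWeightBasis.constr ℝ fun i : b.support => if (i : ι) ∈ J then 0 else 1

section offHeight

variable [P.IsRootSystem] (J : Set ι)

theorem offHeight_of_mem {j : ι} (hs : j ∈ b.support) (hj : j ∈ J) :
    offHeight b J (P.root j) = 0 := by
  have := b.toWeightBasis.constr_basis ℝ
    (open Classical in fun i : b.support => if (i : ι) ∈ J then (0 : ℝ) else 1) ⟨j, hs⟩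
  rw [Base.toWeightBasis_apply] at this
  exact this.trans (by simp [hj])

theorem offHeight_of_notMem {j : ι} (hs : j ∈ b.support) (hj : j ∉ J) :
    offHeight b J (P.root j) = 1 := by
  have := b.toWeightBasis.constr_basis ℝ
    (open Classical in fun i : b.support => if (i : ι) ∈ J then (0 : ℝ) else 1) ⟨j, hs⟩
  rw [Base.toWeightBasis_apply] at this
  exact this.trans (by simp [hj])

theorem offHeight_simple_nonneg {j : ι} (hs : j ∈ b.support) :
    0 ≤ offHeight b J (P.root j) := by
  by_cases hj : j ∈ J
  · rw [offHeight_of_mem b J hs hj]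
  · rw [offHeight_of_notMem b J hs hj]; norm_num

theorem offHeight_empty (i : ι) : offHeight b ∅ (P.root i) = b.height i := by
  obtain ⟨f, -, -, hf⟩ := b.exists_root_eq_sum_int i
  rw [Base.height_eq_sum hf, hf, map_sum]
  push_cast
  refine Finset.sum_congr rfl fun j hj => ?_
  rw [map_zsmul, offHeight_of_notMem b ∅ hj (Set.notMem_empty j)]
  simp

theorem isPos_iff_offHeight (i : ι) : b.IsPos i ↔ 0 < offHeight b ∅ (P.root i) := by
  rw [offHeight_empty, Base.isPos_iff]; exact_mod_cast Iff.rfl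

theorem not_isPos_iff_offHeight (i : ι) : ¬ b.IsPos i ↔ offHeight b ∅ (P.root i) < 0 := by
  rw [offHeight_empty, Base.isPos_iff']
  push Not; exact_mod_cast Iff.rfl

theorem exists_root_eq_sum_of_isPos {i : ι} (hi : b.IsPos i) :
    ∃ f : ι → ℕ, P.root i = ∑ j ∈ b.support, f j • P.root j := by
  obtain ⟨f, -, h | h⟩ := b.exists_root_eq_sum_nat_or_neg i
  · exact ⟨f, h⟩
  · exfalso
    rw [isPos_iff_offHeight, h, map_neg, map_sum] at hi
    have : 0 ≤ ∑ j ∈ b.support, offHeight b ∅ (f j • P.root j) := by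
      refine Finset.sum_nonneg fun j hj => ?_
      rw [map_nsmul]
      exact nsmul_nonneg (offHeight_simple_nonneg b ∅ hj) _
    linarith

theorem offHeight_nonneg_of_isPos {i : ι} (hi : b.IsPos i) : 0 ≤ offHeight b J (P.root i) := by
  obtain ⟨f, h⟩ := exists_root_eq_sum_of_isPos b hi
  rw [h, map_sum]
  refine Finset.sum_nonneg fun j hj => ?_
  rw [map_nsmul]
  exact nsmul_nonneg (offHeight_simple_nonneg b J hj) _

theorem isPos_of_offHeight_pos {i : ι} (hi : 0 < offHeight b J (P.root i)) : b.IsPos i := by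
  by_contra h
  rw [← isPos_reflectionPerm_self] at h
  have := offHeight_nonneg_of_isPos b J h
  rw [root_reflectionPerm_self, map_neg] at this
  linarith

variable {J} (hJ : J ⊆ b.support)
include hJ

theorem offHeight_of_inJ {i : ι} (hi : InJ P J i) : offHeight b J (P.root i) = 0 := by
  unfold InJ at hi
  generalize P.root i = v at hi
  induction hi using AddSubgroup.closure_induction with
  | mem x hx =>
    obtain ⟨j, hj, rfl⟩ := hx
    exact offHeight_of_mem b J (hJ hj) hj
  | zero => simp
  | add x y _ _ hx hy => rw [map_add, hx, hy, add_zero]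
  | neg x _ hx => rw [map_neg, hx, neg_zero]

omit hJ in
theorem sum_mem_of_offHeight_eq_zero {f : ι → ℕ}
    (h : offHeight b J (∑ j ∈ b.support, f j • P.root j) = 0) {j : ι} (hj : j ∈ b.support)
    (hjJ : j ∉ J) : f j = 0 := by
  rw [map_sum, Finset.sum_eq_zero_iff_of_nonneg] at h
  · have := h j hj
    rw [map_nsmul, offHeight_of_notMem b J hj hjJ] at this
    simpa using this
  · intro j hj
    rw [map_nsmul]
    exact nsmul_nonneg (offHeight_simple_nonneg b J hj) _

/-- The simple-root coefficients of a root all have one sign, so if those outside `J` sum to zero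
they all vanish. -/
theorem inJ_iff (i : ι) : InJ P J i ↔ offHeight b J (P.root i) = 0 := by
  refine ⟨offHeight_of_inJ b hJ, fun h => ?_⟩
  have key (f : ι → ℕ) (hf : offHeight b J (∑ j ∈ b.support, f j • P.root j) = 0) :
      ∑ j ∈ b.support, f j • P.root j ∈ AddSubgroup.closure (P.root '' J) := by
    refine sum_mem fun j hj => ?_
    by_cases hjJ : j ∈ J
    · exact nsmul_mem (AddSubgroup.subset_closure (Set.mem_image_of_mem _ hjJ)) _
    · rw [sum_mem_of_offHeight_eq_zero b hf hj hjJ, zero_smul]; exact zero_mem _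
  unfold InJ
  obtain ⟨f, -, hf | hf⟩ := b.exists_root_eq_sum_nat_or_neg i
  · rw [hf] at h ⊢; exact key f h
  · rw [hf] at h ⊢; rw [map_neg, neg_eq_zero] at h; exact neg_mem (key f h)

theorem isPos_and_not_inJ_iff (i : ι) :
    (b.IsPos i ∧ ¬ InJ P J i) ↔ 0 < offHeight b J (P.root i) := by
  rw [inJ_iff b hJ]
  constructor
  · rintro ⟨h1, h2⟩
    exact lt_of_le_of_ne (offHeight_nonneg_of_isPos b J h1) (Ne.symm h2)
  · intro h
    exact ⟨isPos_of_offHeight_pos b J h, h.ne'⟩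

end offHeight

/-- The indicator of the negative roots. -/
def negInd (i : ι) : ℤ := open Classical in if b.IsPos i then 0 else 1

theorem negInd_of_isPos {i : ι} (h : b.IsPos i) : negInd b i = 0 := by simp [negInd, h]

theorem negInd_of_not_isPos {i : ι} (h : ¬ b.IsPos i) : negInd b i = 1 := by simp [negInd, h]

theorem negInd_eq_zero_iff {i : ι} : negInd b i = 0 ↔ b.IsPos i := by
  by_cases h : b.IsPos i <;> simp [negInd, h]

theorem negInd_mem (i : ι) : 0 ≤ negInd b i ∧ negInd b i ≤ 1 := by
  by_cases h : b.IsPos i <;> simp [negInd, h]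

theorem negInd_neg (i : ι) : negInd b (P.reflectionPerm i i) = 1 - negInd b i := by
  by_cases h : b.IsPos i
  · rw [negInd_of_isPos b h, negInd_of_not_isPos b]
    · norm_num
    · rw [isPos_reflectionPerm_self]; exact not_not.mpr h
  · rw [negInd_of_not_isPos b h, negInd_of_isPos b]
    · norm_num
    · rw [isPos_reflectionPerm_self]; exact h

theorem smul_reflectionPerm_self (g : P.Aut) (i : ι) :
    g • P.reflectionPerm i i = P.reflectionPerm (g • i) (g • i) := by
  apply P.root.injective
  rw [root_smul, root_reflectionPerm, reflection_apply_self, smul_neg, root_reflectionPerm,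
    reflection_apply_self, root_smul]

theorem negInd_smul_neg (g : P.Aut) (i : ι) :
    negInd b (g • P.reflectionPerm i i) = 1 - negInd b (g • i) := by
  rw [smul_reflectionPerm_self, negInd_neg]

theorem root_smul_reflectionPerm (g : P.Aut) (c i : ι) :
    P.root (g • P.reflectionPerm c i) = P.root (g • i) - P.pairing i c • P.root (g • c) := by
  rw [root_smul, root_reflectionPerm, reflection_apply_root, smul_sub, smul_smul_real, root_smul,
    root_smul]

theorem root_reflectionPerm' (c i : ι) :
    P.root (P.reflectionPerm c i) = P.root i - P.pairing i c • P.root c := by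
  rw [root_reflectionPerm, reflection_apply_root]

end Finite

/-! ### Inversions outside `Δ_J` and how a reflection changes their number. -/

section Counting

variable {ι V N : Type*} [Fintype ι] [AddCommGroup V] [Module ℝ V] [AddCommGroup N] [Module ℝ N]
  {P : RootPairing ι ℝ V N} [P.IsRootSystem] (b : P.Base) (J : Set ι)

open Classical in
/-- The positive roots that are not in `Δ_J`. -/
def outer : Finset ι := {i | 0 < offHeight b J (P.root i)}

open Classical in
/-- The roots of `outer b J` that the reflection in `γ` moves out of it. -/
def outerDrop (γ : ι) : Finset ι :=
  {i | 0 < offHeight b J (P.root i) ∧ offHeight b J (P.root (P.reflectionPerm γ i)) ≤ 0}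

theorem mem_outer (i : ι) : i ∈ outer b J ↔ 0 < offHeight b J (P.root i) := by simp [outer]

theorem mem_outerDrop (γ i : ι) : i ∈ outerDrop b J γ ↔
    0 < offHeight b J (P.root i) ∧ offHeight b J (P.root (P.reflectionPerm γ i)) ≤ 0 := by
  simp [outerDrop]

theorem outerDrop_subset (γ : ι) : outerDrop b J γ ⊆ outer b J := fun i hi =>
  (mem_outer b J i).2 ((mem_outerDrop b J γ i).1 hi).1

/-- The reflection permutes the roots of `outer` that it keeps inside, so their contributions
cancel. Applied to signs and to coroot pairings, this puts the change of `invCount` and `rhoPairing`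
over the same index set, where they can be compared term by term. -/
theorem sum_outer_reflectionPerm_sub {R : Type*} [CommRing R] (F : ι → R) (γ : ι) :
    ∑ i ∈ outer b J, F (P.reflectionPerm γ i) - ∑ i ∈ outer b J, F i =
      ∑ i ∈ outerDrop b J γ, (F (P.reflectionPerm γ i) - F i) := by
  classical
  rw [← Finset.sum_sdiff (outerDrop_subset b J γ), ← Finset.sum_sdiff (outerDrop_subset b J γ),
    Finset.sum_sub_distrib]
  have : ∑ i ∈ outer b J \ outerDrop b J γ, F (P.reflectionPerm γ i) =
      ∑ i ∈ outer b J \ outerDrop b J γ, F i := by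
    refine Finset.sum_nbij' (P.reflectionPerm γ) (P.reflectionPerm γ) ?_ ?_ ?_ ?_ ?_
    · intro i
      simp only [Finset.mem_sdiff, mem_outer, mem_outerDrop, reflectionPerm_self]
      rintro ⟨h1, h2⟩
      rw [not_and, not_le] at h2
      exact ⟨h2 h1, fun h => absurd h.2 (not_le.2 h1)⟩
    · intro i
      simp only [Finset.mem_sdiff, mem_outer, mem_outerDrop, reflectionPerm_self]
      rintro ⟨h1, h2⟩
      rw [not_and, not_le] at h2
      exact ⟨h2 h1, fun h => absurd h.2 (not_le.2 h1)⟩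
    · intro i _; simp
    · intro i _; simp
    · intro i _; rfl
  rw [this]; ring

/-- The number of roots `α ∈ Δ⁺ \ Δ_J⁺` with `g α < 0`. -/
def invCount (g : P.Aut) : ℤ := ∑ i ∈ outer b J, negInd b (g • i)

theorem invCount_mul_reflection_sub (g : P.Aut) (γ : ι) :
    invCount b J (g * Equiv.reflection P γ) - invCount b J g =
      ∑ i ∈ outerDrop b J γ, (negInd b (g • P.reflectionPerm γ i) - negInd b (g • i)) :=
  sum_outer_reflectionPerm_sub b J (fun i => negInd b (g • i)) γ

theorem invCount_mul_of_preserves (g u : P.Aut)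
    (hu : ∀ v, offHeight b J (u • v) = offHeight b J v) :
    invCount b J (g * u) = invCount b J g := by
  have hu' (v : V) : offHeight b J (u⁻¹ • v) = offHeight b J v := by
    rw [← hu (u⁻¹ • v), smul_inv_smul]
  refine Finset.sum_nbij' (u • ·) (u⁻¹ • ·) ?_ ?_ ?_ ?_ ?_
  · intro i hi
    rw [mem_outer] at hi ⊢
    rwa [root_smul, hu]
  · intro i hi
    rw [mem_outer] at hi ⊢
    rwa [root_smul, hu']
  · intro i _; simp
  · intro i _; simp
  · intro i _; exact congrArg (negInd b) (mul_smul g u i)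

omit [Fintype ι] in
theorem offHeight_reflectionPerm (γ i : ι) :
    offHeight b J (P.root (P.reflectionPerm γ i)) =
      offHeight b J (P.root i) - P.pairing i γ * offHeight b J (P.root γ) := by
  rw [root_reflectionPerm', map_sub, map_smul, smul_eq_mul]

section

variable {γ : ι} (hγ : 0 < offHeight b J (P.root γ))
include hγ

theorem self_mem_outerDrop : γ ∈ outerDrop b J γ := by
  rw [mem_outerDrop, offHeight_reflectionPerm, pairing_same]
  exact ⟨hγ, by linarith⟩

theorem pairing_pos_of_mem_outerDrop {i : ι} (hi : i ∈ outerDrop b J γ) : 0 < P.pairing i γ := by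
  rw [mem_outerDrop, offHeight_reflectionPerm] at hi
  by_contra! h
  have := mul_nonpos_of_nonpos_of_nonneg h hγ.le
  linarith [hi.1, hi.2]

variable [P.IsCrystallographic]

theorem pairingIn_pos_of_mem_outerDrop {i : ι} (hi : i ∈ outerDrop b J γ) :
    1 ≤ P.pairingIn ℤ γ i := by
  have h := pairing_pos_of_mem_outerDrop b J hγ hi
  rw [← P.algebraMap_pairingIn ℤ] at h
  have h' : 0 < P.pairingIn ℤ i γ := by simpa using h
  exact (P.zero_lt_pairingIn_iff' ℤ).1 h'

omit [Fintype ι] [P.IsCrystallographic] hγ in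
theorem isPos_smul_reflectionPerm (g : P.Aut) {i : ι} (hp : 0 < P.pairing i γ)
    (hg : b.IsPos (g • γ)) (h : b.IsPos (g • P.reflectionPerm γ i)) : b.IsPos (g • i) := by
  rw [isPos_iff_offHeight] at *
  rw [root_smul_reflectionPerm, map_sub, LinearMap.map_smul, smul_eq_mul] at h
  have := mul_pos hp hg
  linarith

omit [P.IsCrystallographic] in
-- On `outerDrop` the pairing with `γ^∨` is positive, so `g s_γ α` is `gα` minus a positive multiple
-- of the positive root `gγ`; it cannot be positive with `gα` negative.
theorem invCount_diff_nonneg (g : P.Aut) (hg : b.IsPos (g • γ)) {i : ι}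
    (hi : i ∈ outerDrop b J γ) :
    0 ≤ negInd b (g • P.reflectionPerm γ i) - negInd b (g • i) := by
  by_cases h : b.IsPos (g • P.reflectionPerm γ i)
  · rw [negInd_of_isPos b h, negInd_of_isPos b (isPos_smul_reflectionPerm b g
      (pairing_pos_of_mem_outerDrop b J hγ hi) hg h), sub_zero]
  · rw [negInd_of_not_isPos b h]
    linarith [(negInd_mem b (g • i)).2]

omit [P.IsCrystallographic] in
theorem invCount_mul_reflection_pos (g : P.Aut) (hg : b.IsPos (g • γ)) :
    1 ≤ invCount b J (g * Equiv.reflection P γ) - invCount b J g := by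
  rw [invCount_mul_reflection_sub]
  refine le_trans ?_ (Finset.single_le_sum (fun i hi => invCount_diff_nonneg b J hγ g hg hi)
    (self_mem_outerDrop b J hγ))
  rw [negInd_smul_neg, negInd_of_isPos b hg]; norm_num

omit [P.IsCrystallographic] in
theorem invCount_mul_reflection_neg (g : P.Aut) (hg : ¬ b.IsPos (g • γ)) :
    invCount b J (g * Equiv.reflection P γ) - invCount b J g ≤ -1 := by
  have h1 : b.IsPos ((g * Equiv.reflection P γ) • γ) := by
    rw [mul_smul, reflection_smul_index, smul_reflectionPerm_self, isPos_reflectionPerm_self]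
    exact hg
  have := invCount_mul_reflection_pos b J hγ (g * Equiv.reflection P γ) h1
  rw [mul_assoc, reflection_mul_self, mul_one] at this
  linarith

omit [P.IsCrystallographic] in
-- The root `γ` alone contributes `1` and every other term is nonnegative, so the others vanish.
theorem negInd_eq_of_invCount_eq_one (g : P.Aut) (hg : b.IsPos (g • γ))
    (h : invCount b J (g * Equiv.reflection P γ) - invCount b J g = 1) {i : ι}
    (hi : i ∈ outerDrop b J γ) (hne : i ≠ γ) :
    negInd b (g • P.reflectionPerm γ i) = negInd b (g • i) := by
  classical
  rw [invCount_mul_reflection_sub, ← Finset.add_sum_erase _ _ (self_mem_outerDrop b J hγ),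
    negInd_smul_neg, negInd_of_isPos b hg] at h
  have h0 : ∑ i ∈ (outerDrop b J γ).erase γ,
      (negInd b (g • P.reflectionPerm γ i) - negInd b (g • i)) = 0 := by linarith
  rw [Finset.sum_eq_zero_iff_of_nonneg] at h0
  · exact sub_eq_zero.1 (h0 i (Finset.mem_erase.2 ⟨hne, hi⟩))
  · intro j hj
    exact invCount_diff_nonneg b J hγ g hg (Finset.mem_of_mem_erase hj)

/-- `2 ⟨ρ^∨ - ρ_J^∨, γ⟩`. -/
def rhoPairing (γ : ι) : ℤ := ∑ i ∈ outer b J, P.pairingIn ℤ γ i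

omit [Fintype ι] [P.IsRootSystem] hγ in
theorem pairingIn_reflectionPerm (γ i : ι) :
    P.pairingIn ℤ γ (P.reflectionPerm γ i) = - P.pairingIn ℤ γ i := by
  have : P.pairing γ (P.reflectionPerm γ i) = - P.pairing γ i := by
    rw [pairing_reflectionPerm, pairing_reflectionPerm_self_left]
  rw [← P.algebraMap_pairingIn ℤ, ← P.algebraMap_pairingIn ℤ] at this
  have h : ((P.pairingIn ℤ γ (P.reflectionPerm γ i) : ℤ) : ℝ) = -(P.pairingIn ℤ γ i : ℤ) := by
    simpa using this
  exact_mod_cast h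

omit hγ in
-- The function `α ↦ ⟨α^∨, γ⟩` is odd under `s_γ`, so `sum_outer_reflectionPerm_sub` yields this
-- identity multiplied by `-2`.
theorem rhoPairing_eq (γ : ι) :
    rhoPairing b J γ = ∑ i ∈ outerDrop b J γ, P.pairingIn ℤ γ i := by
  have := sum_outer_reflectionPerm_sub b J (fun i => P.pairingIn ℤ γ i) γ
  simp only [pairingIn_reflectionPerm, Finset.sum_neg_distrib, Finset.sum_sub_distrib] at this
  unfold rhoPairing
  linarith

omit hγ in
theorem rhoPairing_eq_zero {γ : ι}
    (hγ : offHeight b J (P.root γ) = 0) : rhoPairing b J γ = 0 := by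
  rw [rhoPairing_eq]
  refine Finset.sum_eq_zero fun i hi => ?_
  rw [mem_outerDrop, offHeight_reflectionPerm, hγ] at hi
  linarith [hi.1, hi.2]

theorem neg_diff_le_pairing (g : P.Aut) {i : ι} (hi : i ∈ outerDrop b J γ) :
    0 ≤ (negInd b (g • P.reflectionPerm γ i) - negInd b (g • i)) + P.pairingIn ℤ γ i := by
  have := pairingIn_pos_of_mem_outerDrop b J hγ hi
  linarith [(negInd_mem b (g • i)).2, (negInd_mem b (g • P.reflectionPerm γ i)).1]

/-- Each sign change is at least `-1`, and each pairing `⟨α^∨, γ⟩` on `outerDrop` is at least `1`,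
so every term of their sum is nonnegative. The extra `1` comes from `α = γ`, where the pairing is
`2`. -/
theorem rhoPairing_lower (g : P.Aut) : 1 - rhoPairing b J γ ≤
    invCount b J (g * Equiv.reflection P γ) - invCount b J g := by
  rw [invCount_mul_reflection_sub, rhoPairing_eq]
  have h : (negInd b (g • P.reflectionPerm γ γ) - negInd b (g • γ)) + P.pairingIn ℤ γ γ ≤ _ :=
    Finset.single_le_sum (fun i hi => neg_diff_le_pairing b J hγ g hi) (self_mem_outerDrop b J hγ)
  rw [Finset.sum_add_distrib, pairingIn_same] at h
  linarith [(negInd_mem b (g • γ)).2, (negInd_mem b (g • P.reflectionPerm γ γ)).1]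

theorem rhoPairing_upper (g : P.Aut) : invCount b J (g * Equiv.reflection P γ) - invCount b J g ≤
    rhoPairing b J γ - 1 := by
  have := rhoPairing_lower b J hγ (g * Equiv.reflection P γ)
  rw [mul_assoc, reflection_mul_self, mul_one] at this
  linarith

theorem two_le_rhoPairing : 2 ≤ rhoPairing b J γ := by
  rw [rhoPairing_eq]
  have h : P.pairingIn ℤ γ γ ≤ _ := Finset.single_le_sum
    (fun i hi => zero_le_one.trans (pairingIn_pos_of_mem_outerDrop b J hγ hi))
    (self_mem_outerDrop b J hγ)
  rwa [pairingIn_same] at h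

/-- Equality case of `rhoPairing_lower`: the total slack is `1`, and `γ` already uses it, so no
other root has any slack. -/
theorem of_invCount_eq_rhoPairing (g : P.Aut)
    (h : invCount b J (g * Equiv.reflection P γ) - invCount b J g =
      1 - rhoPairing b J γ) {i : ι} (hi : i ∈ outerDrop b J γ) (hne : i ≠ γ) :
    negInd b (g • P.reflectionPerm γ i) - negInd b (g • i) = -1 ∧ P.pairingIn ℤ γ i = 1 := by
  classical
  have h0 : ∑ i ∈ outerDrop b J γ,
      ((negInd b (g • P.reflectionPerm γ i) - negInd b (g • i)) + P.pairingIn ℤ γ i) = 1 := by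
    rw [Finset.sum_add_distrib, ← rhoPairing_eq b J, ← invCount_mul_reflection_sub, h]
    ring
  rw [← Finset.add_sum_erase _ _ (self_mem_outerDrop b J hγ), pairingIn_same] at h0
  have h1 : (negInd b (g • P.reflectionPerm γ i) - negInd b (g • i)) + P.pairingIn ℤ γ i ≤ _ :=
    Finset.single_le_sum
      (fun i hi => neg_diff_le_pairing b J hγ g (Finset.mem_of_mem_erase hi))
      (Finset.mem_erase.2 ⟨hne, hi⟩)
  have h2 := pairingIn_pos_of_mem_outerDrop b J hγ hi
  have := negInd_mem b (g • i)
  have := negInd_mem b (g • P.reflectionPerm γ i)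
  have := negInd_mem b (g • γ)
  have := negInd_mem b (g • P.reflectionPerm γ γ)
  constructor <;> linarith

omit [P.IsCrystallographic] in
/-- A function on roots that is odd under negation and vanishes on the roots of
`outerDrop b J γ` other than `γ` and on those orthogonal to `γ` vanishes on the image of `Δ_J` under
the reflection in `γ`. -/
theorem eq_zero_of_odd (F : ι → ℤ) (hodd : ∀ i, F (P.reflectionPerm i i) = -F i)
    (hD : ∀ i ∈ outerDrop b J γ, i ≠ γ → F i = 0)
    (h0 : ∀ i, P.pairing i γ = 0 → F i = 0) {i : ι} (hi : offHeight b J (P.root i) = 0) :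
    F (P.reflectionPerm γ i) = 0 := by
  -- With negative pairing, `s_γ` adds a positive multiple of `γ` to a root of `Δ_J`. The result
  -- lies in `outerDrop`, because `s_γ` takes it back to `Δ_J`. It is not `γ`, since `-γ` is not in
  -- `Δ_J`. Oddness handles positive pairing.
  have key (i : ι) (hi : offHeight b J (P.root i) = 0) (h : P.pairing i γ < 0) :
      F (P.reflectionPerm γ i) = 0 := by
    apply hD
    · rw [mem_outerDrop, reflectionPerm_self, hi, offHeight_reflectionPerm, hi]
      have := mul_neg_of_neg_of_pos h hγ
      exact ⟨by linarith, le_rfl⟩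
    · intro h
      have h2 := congrArg (P.reflectionPerm γ) h
      rw [reflectionPerm_self] at h2
      rw [h2, root_reflectionPerm_self, map_neg] at hi
      linarith
  rcases lt_trichotomy (P.pairing i γ) 0 with h | h | h
  · exact key i hi h
  · apply h0
    rw [← pairing_reflectionPerm, pairing_reflectionPerm_self_right, h, neg_zero]
  · have := key (P.reflectionPerm i i) (by rw [root_reflectionPerm_self, map_neg, hi, neg_zero])
      (by rw [pairing_reflectionPerm_self_left]; linarith)
    have h2 := smul_reflectionPerm_self (Equiv.reflection P γ) i
    simp only [reflection_smul_index] at h2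
    rw [h2, hodd] at this
    linarith

end

end Counting

/-! ### The length function as the number of inversions. -/

section Length

variable {ι V N : Type*} [Fintype ι] [AddCommGroup V] [Module ℝ V] [AddCommGroup N] [Module ℝ N]
  {P : RootPairing ι ℝ V N}

/-- The action of automorphisms of the root system on `𝔥_af^*`, trivial on `δ` and `Λ₀`. -/
def emb (P : RootPairing ι ℝ V N) : P.Aut →* (AffWt V ≃ₗ[ℝ] AffWt V) where
  toFun g := (Equiv.weightHom P g).prodCongr (LinearEquiv.refl ℝ (ℝ × ℝ))
  map_one' := by rw [map_one]; rfl
  map_mul' g h := by rw [map_mul]; rfl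

omit [Fintype ι] in
theorem emb_apply (g : P.Aut) (μ : AffWt V) : emb P g μ = (g • μ.1, μ.2) := rfl

omit [Fintype ι] in
theorem emb_injective : Function.Injective (emb P) := by
  intro g h hgh
  refine aut_ext fun v => ?_
  exact congrArg Prod.fst (LinearEquiv.congr_fun hgh ((v, 0) : AffWt V))

theorem s_apply (i : ι) (n : ℤ) (μ : AffWt V) :
    s P i n μ = μ - (P.toLinearMap μ.1 (P.coroot i) + μ.2.2 * n) • affRoot P i n := by
  unfold s
  rw [Module.reflection_apply]
  simp [affPairing_apply, affCoroot]

theorem s_zero_eq (i : ι) : s P i 0 = emb P (Equiv.reflection P i) := by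
  ext1 μ
  rw [s_apply, emb_apply, Equiv.reflection_smul, reflection_apply]
  refine Prod.ext ?_ (Prod.ext ?_ ?_) <;> simp [affRoot]

theorem mem_W_iff {w : AffWt V ≃ₗ[ℝ] AffWt V} : w ∈ W P ↔ ∃ g ∈ P.weylGroup, emb P g = w := by
  have : W P = P.weylGroup.map (emb P) := by
    unfold W weylGroup
    rw [MonoidHom.map_closure]
    congr 1
    ext w
    constructor
    · rintro ⟨i, rfl⟩; exact ⟨_, ⟨i, rfl⟩, (s_zero_eq i).symm⟩
    · rintro ⟨_, ⟨i, rfl⟩, rfl⟩; exact ⟨i, (s_zero_eq i).symm⟩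
  rw [this]; rfl

theorem emb_mem_W {g : P.Aut} (hg : g ∈ P.weylGroup) : emb P g ∈ W P := mem_W_iff.2 ⟨g, hg, rfl⟩

theorem mem_WJ {J : Set ι} {u : AffWt V ≃ₗ[ℝ] AffWt V} (hu : u ∈ WJ P J) :
    ∃ g ∈ Subgroup.closure (Equiv.reflection P '' J), emb P g = u := by
  have : WJ P J = (Subgroup.closure (Equiv.reflection P '' J)).map (emb P) := by
    unfold WJ
    rw [MonoidHom.map_closure]
    congr 1
    ext w
    constructor
    · rintro ⟨i, hi, rfl⟩; exact ⟨_, ⟨i, hi, rfl⟩, (s_zero_eq i).symm⟩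
    · rintro ⟨_, ⟨i, hi, rfl⟩, rfl⟩; exact ⟨i, hi, (s_zero_eq i).symm⟩
  rwa [this] at hu

omit [Fintype ι] in
theorem parabolic_le_weylGroup (J : Set ι) :
    Subgroup.closure (Equiv.reflection P '' J) ≤ P.weylGroup :=
  Subgroup.closure_mono (Set.image_subset_range _ _)

omit [Fintype ι] in
theorem parabolic_smul {J : Set ι} {g : P.Aut}
    (hg : g ∈ Subgroup.closure (Equiv.reflection P '' J)) :
    ∀ v : V, (∀ j ∈ J, P.toLinearMap v (P.coroot j) = 0) → g • v = v := by
  induction hg using Subgroup.closure_induction with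
  | mem x hx =>
    obtain ⟨j, hj, rfl⟩ := hx
    intro v hv
    rw [Equiv.reflection_smul, reflection_apply]
    change v - P.toLinearMap v (P.coroot j) • _ = v
    rw [hv j hj, zero_smul, sub_zero]
  | one => intro v _; exact one_smul _ v
  | mul x y _ _ hx hy => intro v hv; rw [mul_smul, hy v hv, hx v hv]
  | inv x _ hx => intro v hv; rw [inv_smul_eq_iff, hx v hv]

variable (b : P.Base)

omit [Fintype ι] in
theorem offHeight_parabolic [P.IsRootSystem] {J : Set ι} (hJ : J ⊆ b.support) {g : P.Aut}
    (hg : g ∈ Subgroup.closure (Equiv.reflection P '' J)) :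
    ∀ v : V, offHeight b J (g • v) = offHeight b J v := by
  induction hg using Subgroup.closure_induction with
  | mem x hx =>
    obtain ⟨j, hj, rfl⟩ := hx
    intro v
    rw [Equiv.reflection_smul, reflection_apply, map_sub, LinearMap.map_smul,
      offHeight_of_mem b J (hJ hj) hj, smul_zero, sub_zero]
  | one => intro v; rw [one_smul]
  | mul x y _ _ hx hy => intro v; rw [mul_smul, hx, hy]
  | inv x _ hx => intro v; rw [← hx, smul_inv_smul]

/-- The product of the reflections in the roots of a list. -/
def word (P : RootPairing ι ℝ V N) (l : List ι) : P.Aut := (l.map (Equiv.reflection P)).prod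

theorem emb_word (l : List ι) : emb P (word P l) = (l.map fun i => s P i 0).prod := by
  unfold word
  rw [map_list_prod, List.map_map]
  congr 1
  exact List.map_congr_left fun i _ => (s_zero_eq i).symm

variable [P.IsCrystallographic] [P.IsReduced]

theorem reflection_mem_closure_simple (i : ι) :
    Equiv.reflection P i ∈ Subgroup.closure (Equiv.reflection P '' (b.support : Set ι)) := by
  refine b.induction_reflect i (p := fun i => Equiv.reflection P i ∈
    Subgroup.closure (Equiv.reflection P '' (b.support : Set ι))) ?_ ?_ ?_
  · intro i hi
    have := conj_reflection (Equiv.reflection P i) i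
    rw [reflection_smul_index] at this
    rw [← this]
    exact mul_mem (mul_mem hi hi) (inv_mem hi)
  · intro i hi
    exact Subgroup.subset_closure ⟨i, hi, rfl⟩
  · intro i j hi hj
    have := conj_reflection (Equiv.reflection P j) i
    rw [reflection_smul_index] at this
    rw [← this]
    have hj' : Equiv.reflection P j ∈
      Subgroup.closure (Equiv.reflection P '' (b.support : Set ι)) :=
      Subgroup.subset_closure ⟨j, hj, rfl⟩
    exact mul_mem (mul_mem hj' hi) (inv_mem hj')

theorem exists_word {g : P.Aut} (hg : g ∈ P.weylGroup) :
    ∃ l : List ι, (∀ i ∈ l, i ∈ b.support) ∧ word P l = g := by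
  have h : g ∈ Subgroup.closure (Equiv.reflection P '' (b.support : Set ι)) := by
    refine (Subgroup.closure_le _).2 ?_ hg
    rintro _ ⟨i, rfl⟩
    exact reflection_mem_closure_simple b i
  induction h using Subgroup.closure_induction_right with
  | one => exact ⟨[], by simp, rfl⟩
  | mul_right x y hx hy ih =>
    obtain ⟨j, hj, rfl⟩ := hy
    have hjW := P.reflection_mem_weylGroup j
    obtain ⟨l, hl, rfl⟩ := ih ((Subgroup.mul_mem_cancel_right _ hjW).1 hg)
    refine ⟨l ++ [j], ?_, by simp [word]⟩
    intro i hi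
    rcases List.mem_append.1 hi with h | h
    · exact hl i h
    · rw [List.mem_singleton.1 h]; exact hj
  | mul_inv_cancel x y hx hy ih =>
    obtain ⟨j, hj, rfl⟩ := hy
    rw [Equiv.reflection_inv] at hg ⊢
    have hjW := P.reflection_mem_weylGroup j
    obtain ⟨l, hl, rfl⟩ := ih ((Subgroup.mul_mem_cancel_right _ hjW).1 hg)
    refine ⟨l ++ [j], ?_, by simp [word]⟩
    intro i hi
    rcases List.mem_append.1 hi with h | h
    · exact hl i h
    · rw [List.mem_singleton.1 h]; exact hj

theorem exists_exchange (l : List ι) (hl : ∀ i ∈ l, i ∈ b.support) {j : ι} (hj : j ∈ b.support)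
    (hneg : ¬ b.IsPos (word P l • j)) :
    ∃ l' : List ι, (∀ i ∈ l', i ∈ b.support) ∧ l'.length + 1 = l.length ∧
      word P l' = word P l * Equiv.reflection P j := by
  induction l with
  | nil =>
    exact absurd (Base.isPos_of_mem_support hj) (by simpa [word] using hneg)
  | cons i l ih =>
    have hw : word P (i :: l) = Equiv.reflection P i * word P l := by simp [word]
    have hl' : ∀ k ∈ l, k ∈ b.support := fun k hk => hl k (List.mem_cons_of_mem _ hk)
    have hi : i ∈ b.support := hl i List.mem_cons_self
    by_cases h : b.IsPos (word P l • j)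
    · rw [hw, mul_smul, reflection_smul_index] at hneg
      -- The reflection `s_i` makes no positive root negative except `α_i`. So the first letter is
      -- the one to delete.
      have hji : word P l • j = i := by
        by_contra hne
        exact hneg (h.reflectionPerm hi hne)
      refine ⟨l, hl', rfl, ?_⟩
      rw [hw, mul_assoc, mul_reflection, hji, ← mul_assoc, reflection_mul_self, one_mul]
    · obtain ⟨l', h1, h2, h3⟩ := ih hl' h
      refine ⟨i :: l', ?_, by simp [h2], ?_⟩
      · intro k hk
        rcases List.mem_cons.1 hk with rfl | hk
        · exact hi
        · exact h1 k hk
      · rw [hw, mul_assoc, ← h3]; simp [word]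

variable [P.IsRootSystem]

theorem outerDrop_empty {j : ι} (hj : j ∈ b.support) : outerDrop b ∅ j = {j} := by
  ext i
  rw [mem_outerDrop, ← isPos_iff_offHeight, ← not_lt, ← isPos_iff_offHeight, Finset.mem_singleton]
  constructor
  · rintro ⟨h1, h2⟩
    by_contra hne
    exact h2 (h1.reflectionPerm hj hne)
  · rintro rfl
    have := Base.isPos_of_mem_support hj
    refine ⟨this, ?_⟩
    rw [isPos_reflectionPerm_self]
    exact not_not.2 this

theorem invCount_mul_simple (g : P.Aut) {j : ι} (hj : j ∈ b.support) :
    invCount b ∅ (g * Equiv.reflection P j) = invCount b ∅ g + 1 - 2 * negInd b (g • j) := by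
  have := invCount_mul_reflection_sub b ∅ g j
  rw [outerDrop_empty b hj, Finset.sum_singleton, negInd_smul_neg] at this
  linarith

omit [P.IsCrystallographic] [P.IsReduced] in
theorem invCount_one (J : Set ι) : invCount b J 1 = 0 := by
  refine Finset.sum_eq_zero fun i hi => ?_
  rw [mem_outer] at hi
  rw [one_smul, negInd_of_isPos b (isPos_of_offHeight_pos b J hi)]

theorem invCount_word_le (l : List ι) (hl : ∀ i ∈ l, i ∈ b.support) :
    invCount b ∅ (word P l) ≤ l.length := by
  induction l using List.reverseRecOn with
  | nil => simp [word, invCount_one]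
  | append_singleton l j ih =>
    have hw : word P (l ++ [j]) = word P l * Equiv.reflection P j := by simp [word]
    rw [hw, invCount_mul_simple b _ (hl j (by simp))]
    have := ih fun i hi => hl i (by simp [hi])
    push_cast [List.length_append, List.length_singleton]
    linarith [(negInd_mem b (word P l • j)).1]

/-- Build the word letter by letter: a letter that adds an inversion is appended, and one that
removes an inversion is absorbed by the exchange property. -/
theorem exists_reduced_word (l : List ι) (hl : ∀ i ∈ l, i ∈ b.support) :
    ∃ l' : List ι, (∀ i ∈ l', i ∈ b.support) ∧ word P l' = word P l ∧
      (l'.length : ℤ) = invCount b ∅ (word P l) := by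
  induction l using List.reverseRecOn with
  | nil => exact ⟨[], by simp, rfl, by simp [word, invCount_one]⟩
  | append_singleton l j ih =>
    have hj : j ∈ b.support := hl j (by simp)
    have hw : word P (l ++ [j]) = word P l * Equiv.reflection P j := by simp [word]
    obtain ⟨l', h1, h2, h3⟩ := ih fun i hi => hl i (by simp [hi])
    rw [hw, invCount_mul_simple b _ hj]
    by_cases h : b.IsPos (word P l • j)
    · refine ⟨l' ++ [j], ?_, ?_, ?_⟩
      · intro i hi
        rcases List.mem_append.1 hi with h | h
        · exact h1 i h
        · rw [List.mem_singleton.1 h]; exact hj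
      · rw [← h2]; simp [word]
      · rw [negInd_of_isPos b h]
        push_cast [List.length_append, List.length_singleton]
        linarith
    · obtain ⟨l'', h4, h5, h6⟩ := exists_exchange b l' h1 hj (by rwa [h2])
      refine ⟨l'', h4, by rw [h6, h2], ?_⟩
      rw [negInd_of_not_isPos b h, ← h3, ← h5]
      push_cast; ring

theorem len_emb {g : P.Aut} (hg : g ∈ P.weylGroup) : (len b (emb P g) : ℤ) = invCount b ∅ g := by
  obtain ⟨l, hl, rfl⟩ := exists_word b hg
  obtain ⟨l', h1, h2, h3⟩ := exists_reduced_word b l hl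
  have hmem : l'.length ∈ {k | ∃ l : List ι, l.length = k ∧ (∀ i ∈ l, i ∈ b.support) ∧
      emb P (word P l') = (l.map fun i => s P i 0).prod} := ⟨l', rfl, h1, emb_word l'⟩
  apply le_antisymm
  · rw [← h3, ← h2]
    exact_mod_cast Nat.sInf_le hmem
  · rw [← h2]
    obtain ⟨l'', h4, h5, h6⟩ := Nat.sInf_mem ⟨_, hmem⟩
    have h7 : (len b (emb P (word P l'))) = l''.length := h4.symm
    rw [h7]
    rw [← emb_word] at h6
    rw [emb_injective h6]
    exact invCount_word_le b l'' h5

theorem eq_one_of_invCount {g : P.Aut} (hg : g ∈ P.weylGroup) (h : invCount b ∅ g = 0) : g = 1 := by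
  obtain ⟨l, hl, rfl⟩ := exists_word b hg
  obtain ⟨l', h1, h2, h3⟩ := exists_reduced_word b l hl
  rw [h] at h3
  have : l' = [] := List.length_eq_zero_iff.1 (by exact_mod_cast h3)
  rw [← h2, this]; rfl

end Length

/-! ### Minimal coset representatives. -/

section Floor

variable {ι V N : Type*} [Fintype ι] [AddCommGroup V] [Module ℝ V] [AddCommGroup N] [Module ℝ N]
  {P : RootPairing ι ℝ V N} [P.IsCrystallographic] [P.IsReduced] [P.IsRootSystem]
  (b : P.Base) {J : Set ι} (hJ : J ⊆ b.support)

/-- `g` sends the positive roots of `Δ_J` to positive roots. -/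
def KeepsPos (J : Set ι) (g : P.Aut) : Prop :=
  ∀ i, b.IsPos i → offHeight b J (P.root i) = 0 → b.IsPos (g • i)

open Classical in
/-- The positive roots of `Δ_J`. -/
def leviPos (J : Set ι) : Finset ι := {i | b.IsPos i ∧ offHeight b J (P.root i) = 0}

omit [P.IsCrystallographic] [P.IsReduced] in
theorem mem_leviPos {i : ι} :
    i ∈ leviPos b J ↔ b.IsPos i ∧ offHeight b J (P.root i) = 0 := by simp [leviPos]

omit [Fintype ι] [P.IsCrystallographic] [P.IsReduced] in
theorem KeepsPos.negInd_smul {g : P.Aut} (hg : KeepsPos b J g) {i : ι}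
    (hi : offHeight b J (P.root i) = 0) : negInd b (g • i) = negInd b i := by
  by_cases h : b.IsPos i
  · rw [negInd_of_isPos b h, negInd_of_isPos b (hg i h hi)]
  · have h2 := h
    rw [← isPos_reflectionPerm_self] at h2
    have h3 := hg _ h2 (by rw [root_reflectionPerm_self, map_neg, hi, neg_zero])
    rw [smul_reflectionPerm_self, isPos_reflectionPerm_self] at h3
    rw [negInd_of_not_isPos b h, negInd_of_not_isPos b h3]

include hJ

/-- Minimality against `s_j` for `j ∈ J` makes each `gα_j` positive, and a positive root of `Δ_J` is
a nonnegative combination of these `α_j`. -/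
theorem keepsPos_of_mem_WUp {w : AffWt V ≃ₗ[ℝ] AffWt V} (hw : w ∈ WUp b J) :
    ∃ g ∈ P.weylGroup, emb P g = w ∧ KeepsPos b J g := by
  obtain ⟨h1, h2⟩ := hw
  obtain ⟨g, hg, rfl⟩ := mem_W_iff.1 h1
  refine ⟨g, hg, rfl, ?_⟩
  have hsimple (j : ι) (hj : j ∈ J) : b.IsPos (g • j) := by
    have h3 := h2 (s P j 0) (Subgroup.subset_closure ⟨j, hj, rfl⟩)
    rw [s_zero_eq, ← map_mul] at h3
    have h4 : (len b (emb P g) : ℤ) ≤ len b (emb P (g * Equiv.reflection P j)) := by exact_mod_cast h3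
    rw [len_emb b hg, len_emb b (mul_mem hg (P.reflection_mem_weylGroup j)),
      invCount_mul_simple b g (hJ hj)] at h4
    rw [← negInd_eq_zero_iff]
    have := negInd_mem b (g • j)
    omega
  intro i hi h0
  obtain ⟨f, hf⟩ := exists_root_eq_sum_of_isPos b hi
  by_contra hneg
  rw [not_isPos_iff_offHeight, root_smul] at hneg
  have hg' (v : V) : g • v = Equiv.weightHom P g v := rfl
  rw [hf, hg', map_sum, map_sum] at hneg
  refine absurd hneg (not_lt.2 (Finset.sum_nonneg fun j hj => ?_))
  rw [map_nsmul, map_nsmul]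
  by_cases hjJ : j ∈ J
  · have := (isPos_iff_offHeight b _).1 (hsimple j hjJ)
    rw [root_smul, hg'] at this
    exact nsmul_nonneg this.le _
  · rw [hf] at h0
    rw [sum_mem_of_offHeight_eq_zero b h0 hj hjJ, zero_smul]

omit [P.IsCrystallographic] [P.IsReduced] in
theorem invCount_empty_eq (g : P.Aut) : invCount b ∅ g = invCount b J g +
    ∑ i ∈ leviPos b J, negInd b (g • i) := by
  classical
  unfold invCount
  rw [← Finset.sum_union]
  · refine Finset.sum_congr ?_ fun _ _ => rfl
    ext i
    rw [Finset.mem_union, mem_outer, mem_outer, ← isPos_iff_offHeight, mem_leviPos,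
      ← isPos_and_not_inJ_iff b hJ, inJ_iff b hJ]
    tauto
  · rw [Finset.disjoint_left]
    intro i hi
    rw [mem_outer] at hi
    rw [mem_leviPos]
    exact fun h => hi.ne' h.2

omit [P.IsCrystallographic] [P.IsReduced] in
theorem invCount_empty_of_keepsPos {g : P.Aut} (hg : KeepsPos b J g) :
    invCount b ∅ g = invCount b J g := by
  rw [invCount_empty_eq b hJ g, Finset.sum_eq_zero, add_zero]
  intro i hi
  rw [mem_leviPos] at hi
  exact negInd_of_isPos b (hg i hi.1 hi.2)

theorem len_of_keepsPos {g : P.Aut} (hW : g ∈ P.weylGroup) (hg : KeepsPos b J g) :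
    (len b (emb P g) : ℤ) = invCount b J g := by
  rw [len_emb b hW, invCount_empty_of_keepsPos b hJ hg]

omit hJ [P.IsCrystallographic] [P.IsReduced] [P.IsRootSystem] in
theorem exists_floor {w : AffWt V ≃ₗ[ℝ] AffWt V} (hw : w ∈ W P) (hsub : WJ P J ≤ W P) :
    ∃ v ∈ WUp b J, ∃ u ∈ WJ P J, w = v * u := by
  obtain ⟨u, hu, hmin⟩ : ∃ u ∈ WJ P J, ∀ u' ∈ WJ P J, len b (w * u) ≤ len b (w * u') := by
    have hne : {k | ∃ u ∈ WJ P J, len b (w * u) = k}.Nonempty := ⟨_, 1, one_mem _, rfl⟩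
    obtain ⟨u, hu, h⟩ := Nat.sInf_mem hne
    refine ⟨u, hu, fun u' hu' => ?_⟩
    rw [h]
    exact Nat.sInf_le ⟨u', hu', rfl⟩
  refine ⟨w * u, ⟨mul_mem hw (hsub hu), fun u' hu' => ?_⟩, u⁻¹, inv_mem hu, by group⟩
  rw [mul_assoc]
  exact hmin _ (mul_mem hu hu')

omit hJ [P.IsCrystallographic] [P.IsReduced] [P.IsRootSystem] in
theorem WJ_le_W : WJ P J ≤ W P := by
  refine Subgroup.closure_mono ?_
  rintro _ ⟨j, _, rfl⟩
  exact ⟨j, rfl⟩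

/-- The element `u` has no inversions outside `Δ_J`, because it lies in `W_J`, and none inside,
because `g` and `gu` both respect signs there. -/
theorem floor_unique {g u : P.Aut} (hg : KeepsPos b J g) (hgu : KeepsPos b J (g * u))
    (hu : u ∈ Subgroup.closure (Equiv.reflection P '' J)) : u = 1 := by
  have hphi := offHeight_parabolic b hJ hu
  apply eq_one_of_invCount b (parabolic_le_weylGroup J hu)
  have h1 := invCount_mul_of_preserves b J 1 u hphi
  rw [one_mul, invCount_one] at h1
  rw [invCount_empty_of_keepsPos b hJ, h1]
  intro i hi h0
  by_contra hneg
  rw [← isPos_reflectionPerm_self] at hneg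
  have h2 := hg _ hneg (by rw [root_reflectionPerm_self, map_neg, root_smul, hphi, h0, neg_zero])
  rw [smul_reflectionPerm_self, isPos_reflectionPerm_self, ← mul_smul] at h2
  exact h2 (hgu i hi h0)

end Floor

/-! ### Translations and the decomposition of affine Weyl group elements. -/

section Translations

variable {ι V N : Type*} [Fintype ι] [AddCommGroup V] [Module ℝ V] [AddCommGroup N] [Module ℝ N]
  {P : RootPairing ι ℝ V N}

theorem rootForm_smul_smul (g : P.Aut) (x y : V) :
    P.RootForm (g • x) (g • y) = P.RootForm x y := by
  rw [rootForm_apply_apply, rootForm_apply_apply]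
  refine (Fintype.sum_equiv (MulAction.toPerm g) _ _ fun i => ?_).symm
  exact (congrArg₂ (· * ·) (toLinearMap_smul_coroot g x i) (toLinearMap_smul_coroot g y i)).symm

theorem form_smul_smul (g : P.Aut) (x y : V) : form P (g • x) (g • y) = form P x y := by
  unfold form; rw [rootForm_smul_smul]

theorem form_symm (x y : V) : form P x y = form P y x := by
  unfold form
  rw [rootForm_apply_apply, rootForm_apply_apply]
  simp only [mul_comm]

theorem form_root (x : V) (i : ι) : form P (P.root i) x = c P i * P.toLinearMap x (P.coroot i) := by
  have h := congrArg (P.toLinearMap x) (P.rootForm_self_smul_coroot i)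
  rw [map_smul, map_nsmul, toLinearMap_apply_apply_Polarization] at h
  unfold c form
  rw [smul_eq_mul, nsmul_eq_mul] at h
  push_cast at h
  linear_combination (-1 / (⨅ i, P.RootForm (P.root i) (P.root i))) * h

theorem rootForm_root_pos (i : ι) : 0 < P.RootForm (P.root i) (P.root i) := by
  rw [rootForm_root_self]
  exact Finset.sum_pos' (fun j _ => mul_self_nonneg _) ⟨i, Finset.mem_univ i, by simp⟩

theorem c_pos (i : ι) : 0 < c P i := by
  have : Nonempty ι := ⟨i⟩
  obtain ⟨j, hj⟩ := exists_eq_ciInf_of_finite (f := fun i => P.RootForm (P.root i) (P.root i))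
  have h1 : 0 < ⨅ i, P.RootForm (P.root i) (P.root i) := hj ▸ rootForm_root_pos j
  have h2 := rootForm_root_pos (P := P) i
  unfold c form
  positivity

theorem c_smul (g : P.Aut) (i : ι) : c P (g • i) = c P i := by
  unfold c; rw [root_smul, form_smul_smul]

theorem affRoot_inj {i j : ι} {n m : ℤ} (h : affRoot P i n = affRoot P j m) : i = j ∧ n = m := by
  have h1 : i = j := P.root.injective (congrArg Prod.fst h)
  subst h1
  have h2 : n * c P i = m * c P i := congrArg (fun μ => μ.2.1) h
  exact ⟨rfl, by exact_mod_cast mul_right_cancel₀ (c_pos i).ne' h2⟩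

theorem t_apply (ξ : V) (μ : AffWt V) : t P ξ μ =
    (μ.1 + μ.2.2 • ξ, μ.2.1 - (form P μ.1 ξ + form P ξ ξ / 2 * μ.2.2), μ.2.2) := rfl

theorem form_add_right (x y z : V) : form P x (y + z) = form P x y + form P x z := by
  unfold form; rw [map_add]; ring

theorem form_add_left (x y z : V) : form P (x + y) z = form P x z + form P y z := by
  unfold form; rw [map_add, LinearMap.add_apply]; ring

theorem form_smul_left (r : ℝ) (x y : V) : form P (r • x) y = r * form P x y := by
  unfold form; rw [map_smul, LinearMap.smul_apply, smul_eq_mul]; ring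

theorem t_add (ξ ζ : V) : t P (ξ + ζ) = t P ξ * t P ζ := by
  ext1 μ
  rw [LinearEquiv.mul_apply, t_apply, t_apply, t_apply]
  refine Prod.ext ?_ (Prod.ext ?_ rfl)
  · simp only [smul_add]; abel
  · simp only [form_add_right, form_add_left, form_smul_left, form_symm ζ ξ]
    ring

theorem t_zero : t P 0 = 1 := by
  have := t_add (P := P) 0 0
  rw [add_zero] at this
  exact mul_eq_left.1 this.symm

theorem t_neg (ξ : V) : t P (-ξ) = (t P ξ)⁻¹ := by
  rw [eq_inv_iff_mul_eq_one, ← t_add, neg_add_cancel, t_zero]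

theorem t_mul_emb (g : P.Aut) (ξ : V) : t P (g • ξ) * emb P g = emb P g * t P ξ := by
  ext1 μ
  rw [LinearEquiv.mul_apply, LinearEquiv.mul_apply, t_apply, emb_apply, emb_apply, t_apply]
  refine Prod.ext ?_ (Prod.ext ?_ rfl)
  · simp only [smul_add, smul_smul_real]
  · simp only [form_smul_smul]

/-- The factor `c_γ` in the root `γ + n c_γ δ` matches `(γ | x) = c_γ ⟨γ^∨, x⟩`, so the translation
part is `nγ`. This is why the translation lattice is `Q`. -/
theorem s_eq (i : ι) (n : ℤ) :
    s P i n = emb P (Equiv.reflection P i) * t P ((n : ℝ) • P.root i) := by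
  have h (x : V) : form P x ((n : ℝ) • P.root i) = n * (c P i * P.toLinearMap x (P.coroot i)) := by
    rw [form_symm, form_smul_left, form_root]
  ext1 μ
  rw [s_apply, LinearEquiv.mul_apply, emb_apply, t_apply]
  refine Prod.ext ?_ (Prod.ext ?_ ?_)
  · have h2 : P.coroot' i (P.root i) = 2 := by simp
    have h3 : P.coroot' i μ.1 = P.toLinearMap μ.1 (P.coroot i) := rfl
    simp only [smul_add, Equiv.reflection_smul, map_smul, affRoot, reflection_apply, Prod.fst_sub,
      Prod.smul_fst, h2, h3]
    module
  · simp only [h, affRoot, Prod.fst_sub, Prod.snd_sub, Prod.smul_fst, Prod.smul_snd, smul_eq_mul]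
    rw [map_smul]
    simp
    ring
  · simp [affRoot]

omit [Fintype ι] in
theorem smul_mem_Q {g : P.Aut} {ξ : V} (hξ : ξ ∈ Q P) : g • ξ ∈ Q P := by
  unfold Q at *
  induction hξ using AddSubgroup.closure_induction with
  | mem x hx =>
    obtain ⟨i, rfl⟩ := hx
    rw [← root_smul]; exact AddSubgroup.subset_closure ⟨_, rfl⟩
  | zero => rw [smul_zero]; exact zero_mem _
  | add x y _ _ hx hy => rw [smul_add]; exact add_mem hx hy
  | neg x _ hx => rw [smul_neg]; exact neg_mem hx

omit [Fintype ι] in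
theorem intCast_smul_root_mem_Q (n : ℤ) (i : ι) : (n : ℝ) • P.root i ∈ Q P := by
  rw [Int.cast_smul_eq_zsmul]
  exact zsmul_mem (AddSubgroup.subset_closure (Set.mem_range_self i)) n

omit [Fintype ι] in
theorem exists_int_of_mem_Q [P.IsCrystallographic] {ξ : V} (hξ : ξ ∈ Q P) (i : ι) :
    ∃ k : ℤ, P.toLinearMap ξ (P.coroot i) = k := by
  unfold Q at *
  induction hξ using AddSubgroup.closure_induction with
  | mem x hx =>
    obtain ⟨j, rfl⟩ := hx
    exact ⟨P.pairingIn ℤ j i, by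
      rw [root_coroot_eq_pairing, ← P.algebraMap_pairingIn ℤ]; rfl⟩
  | zero => exact ⟨0, by simp⟩
  | add x y _ _ hx hy =>
    obtain ⟨k, hk⟩ := hx
    obtain ⟨l, hl⟩ := hy
    exact ⟨k + l, by rw [map_add, LinearMap.add_apply, hk, hl]; push_cast; rfl⟩
  | neg x _ hx =>
    obtain ⟨k, hk⟩ := hx
    exact ⟨-k, by rw [map_neg, LinearMap.neg_apply, hk]; push_cast; rfl⟩

theorem exists_eq_of_mem_Waf {x : AffWt V ≃ₗ[ℝ] AffWt V} (hx : x ∈ Waf P) :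
    ∃ g ∈ P.weylGroup, ∃ ξ ∈ Q P, x = emb P g * t P ξ := by
  unfold Waf at hx
  induction hx using Subgroup.closure_induction with
  | mem x hx =>
    obtain ⟨i, n, rfl⟩ := hx
    exact ⟨_, P.reflection_mem_weylGroup i, _, intCast_smul_root_mem_Q n i, s_eq i n⟩
  | one => exact ⟨1, one_mem _, 0, zero_mem _, by rw [map_one, t_zero, one_mul]⟩
  | mul x y _ _ hx hy =>
    obtain ⟨g, hg, ξ, hξ, rfl⟩ := hx
    obtain ⟨h, hh, ζ, hζ, rfl⟩ := hy
    refine ⟨g * h, mul_mem hg hh, h⁻¹ • ξ + ζ, add_mem (smul_mem_Q hξ) hζ, ?_⟩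
    have := t_mul_emb h (h⁻¹ • ξ)
    rw [smul_inv_smul] at this
    rw [t_add, map_mul, mul_assoc, ← mul_assoc (t P ξ), this]
    simp only [mul_assoc]
  | inv x _ hx =>
    obtain ⟨g, hg, ξ, hξ, rfl⟩ := hx
    refine ⟨g⁻¹, inv_mem hg, -(g • ξ), neg_mem (smul_mem_Q hξ), ?_⟩
    rw [← t_mul_emb, mul_inv_rev, t_neg, map_inv]

theorem emb_mul_t_inj {g h : P.Aut} {ξ ζ : V} (H : emb P g * t P ξ = emb P h * t P ζ) :
    g = h ∧ ξ = ζ := by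
  have h1 : g = h := by
    refine aut_ext fun v => ?_
    have := congrArg Prod.fst (LinearEquiv.congr_fun H ((v, 0, 0) : AffWt V))
    simpa [LinearEquiv.mul_apply, t_apply, emb_apply] using this
  subst h1
  have h2 := congrArg Prod.fst (LinearEquiv.congr_fun (mul_left_cancel H) ((0, 0, 1) : AffWt V))
  exact ⟨rfl, by simpa [t_apply] using h2⟩

theorem emb_mul_t_affRoot (g : P.Aut) {ξ : V} {i : ι} {k : ℤ}
    (hk : P.toLinearMap ξ (P.coroot i) = k) (n : ℤ) :
    (emb P g * t P ξ) (affRoot P i n) = affRoot P (g • i) (n - k) := by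
  rw [LinearEquiv.mul_apply, emb_apply, t_apply]
  refine Prod.ext ?_ (Prod.ext ?_ rfl)
  · simp [affRoot, root_smul]
  · simp only [affRoot, form_root, hk, c_smul]; push_cast; ring

/-- Labelling the reflection by `gγ` turns left multiplication by it into right multiplication by
`s_γ` and a shift of `ξ`. All later edge computations use this parametrization. -/
theorem s_mul_emb_mul_t (g : P.Aut) (ξ : V) (γ : ι) (n : ℤ) :
    s P (g • γ) n * (emb P g * t P ξ) =
      emb P (g * Equiv.reflection P γ) * t P (ξ + (n : ℝ) • P.root γ) := by
  have h := t_mul_emb g ((n : ℝ) • P.root γ)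
  rw [smul_smul_real, ← root_smul] at h
  rw [s_eq, mul_reflection, map_mul, add_comm ξ, t_add, mul_assoc, mul_assoc, ← mul_assoc (t P _), h]
  simp only [mul_assoc]

theorem s_mem_Waf (i : ι) (n : ℤ) : s P i n ∈ Waf P := Subgroup.subset_closure ⟨i, n, rfl⟩

theorem W_le_Waf : W P ≤ Waf P := by
  refine Subgroup.closure_mono ?_
  rintro _ ⟨i, rfl⟩
  exact ⟨i, 0, rfl⟩

end Translations

/-! ### Peterson representatives, semi-infinite length and edges in terms of `(g, ξ)`. -/

section Peterson

variable {ι V N : Type*} [Fintype ι] [AddCommGroup V] [Module ℝ V] [AddCommGroup N] [Module ℝ N]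
  {P : RootPairing ι ℝ V N} [P.IsCrystallographic] [P.IsRootSystem]
  (b : P.Base) {J : Set ι} (hJ : J ⊆ b.support)

omit [Fintype ι] [P.IsCrystallographic] [P.IsRootSystem] in
theorem affPos_iff (i : ι) (n : ℤ) : AffPos b i n ↔ negInd b i ≤ n := by
  unfold AffPos
  by_cases h : b.IsPos i
  · rw [negInd_of_isPos b h]; simp only [h, and_true]; omega
  · rw [negInd_of_not_isPos b h]; simp only [h, and_false, or_false]; omega

/-- The condition on `g t_ξ` to lie in `(W^J)_af`. -/
def PetCond (J : Set ι) (g : P.Aut) (ξ : V) : Prop :=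
  ∀ i, offHeight b J (P.root i) = 0 →
    P.toLinearMap ξ (P.coroot i) = ((negInd b i - negInd b (g • i) : ℤ) : ℝ)

omit [Fintype ι] [P.IsCrystallographic] [P.IsRootSystem] in
theorem coroot_reflectionPerm_self (i : ι) : P.coroot (P.reflectionPerm i i) = -P.coroot i := by
  rw [coroot_reflectionPerm, coreflection_apply_self]

include hJ

/-- For fixed `γ` it suffices to test the least positive `n`. The tests for `γ` and `-γ` give
opposite inequalities, hence an equation for `⟨γ^∨, ξ⟩`. -/
theorem mem_Pet_iff {g : P.Aut} {ξ : V} (hξ : ξ ∈ Q P) :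
    emb P g * t P ξ ∈ Pet b J ↔ emb P g * t P ξ ∈ Waf P ∧ PetCond b J g ξ := by
  have key (i : ι) (k n : ℤ) (hk : P.toLinearMap ξ (P.coroot i) = k) :
      (∃ j m, AffPos b j m ∧ (emb P g * t P ξ) (affRoot P i n) = affRoot P j m) ↔
        negInd b (g • i) ≤ n - k := by
    rw [emb_mul_t_affRoot g hk]
    constructor
    · rintro ⟨j, m, h1, h2⟩
      obtain ⟨h3, h4⟩ := affRoot_inj h2
      rwa [h3, h4, ← affPos_iff]
    · intro h
      exact ⟨_, _, (affPos_iff b _ _).2 h, rfl⟩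
  refine and_congr_right fun _ => ⟨fun h i hi => ?_, fun h i n hi hn => ?_⟩
  · obtain ⟨k, hk⟩ := exists_int_of_mem_Q hξ i
    have h1 := (key i k _ hk).1 (h i (negInd b i) ((inJ_iff b hJ i).2 hi)
      ((affPos_iff b _ _).2 le_rfl))
    have hi' : offHeight b J (P.root (P.reflectionPerm i i)) = 0 := by
      rw [root_reflectionPerm_self, map_neg, hi, neg_zero]
    have hk' : P.toLinearMap ξ (P.coroot (P.reflectionPerm i i)) = ((-k : ℤ) : ℝ) := by
      rw [coroot_reflectionPerm_self, map_neg, hk]; push_cast; rfl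
    have h2 := (key _ _ _ hk').1 (h _ (negInd b (P.reflectionPerm i i))
      ((inJ_iff b hJ _).2 hi') ((affPos_iff b _ _).2 le_rfl))
    rw [negInd_smul_neg, negInd_neg] at h2
    rw [hk]
    congr 1
    omega
  · rw [affPos_iff] at hn
    rw [key i _ n (h i ((inJ_iff b hJ i).1 hi))]
    omega

theorem exists_of_mem_Pet {x : AffWt V ≃ₗ[ℝ] AffWt V} (hx : x ∈ Pet b J) :
    ∃ g ∈ P.weylGroup, ∃ ξ ∈ Q P, x = emb P g * t P ξ ∧ PetCond b J g ξ := by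
  obtain ⟨g, hg, ξ, hξ, rfl⟩ := exists_eq_of_mem_Waf hx.1
  exact ⟨g, hg, ξ, hξ, rfl, ((mem_Pet_iff b hJ hξ).1 hx).2⟩

omit [P.IsCrystallographic] in
theorem two_mul_rhoCheck (v : V) : 2 * P.toLinearMap v (rhoCheck b J) =
    ∑ i ∈ leviPos b J, P.toLinearMap v (P.coroot i) := by
  classical
  unfold rhoCheck
  rw [map_smul, map_sum, smul_eq_mul]
  have : leviPos b J = Finset.univ.filter fun i => b.IsPos i ∧ InJ P J i := by
    ext i
    rw [mem_leviPos, ← inJ_iff b hJ]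
    simp
  rw [this]
  ring_nf

omit hJ [P.IsCrystallographic] in
theorem leviPos_support : leviPos b (b.support : Set ι) = outer b ∅ := by
  ext i
  rw [mem_leviPos, mem_outer, ← isPos_iff_offHeight, ← inJ_iff b subset_rfl]
  refine and_iff_left ?_
  obtain ⟨f, -, -, hf⟩ := b.exists_root_eq_sum_int i
  unfold InJ
  rw [hf]
  exact sum_mem fun j hj => zsmul_mem (AddSubgroup.subset_closure (Set.mem_image_of_mem _ hj)) _

omit [P.IsCrystallographic] in
theorem sum_outer_empty (F : ι → ℝ) :
    ∑ i ∈ outer b ∅, F i = ∑ i ∈ outer b J, F i + ∑ i ∈ leviPos b J, F i := by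
  classical
  rw [← Finset.sum_union]
  · refine Finset.sum_congr ?_ fun _ _ => rfl
    ext i
    rw [Finset.mem_union, mem_outer, mem_outer, ← isPos_iff_offHeight, mem_leviPos,
      ← isPos_and_not_inJ_iff b hJ, inJ_iff b hJ]
    tauto
  · rw [Finset.disjoint_left]
    intro i hi
    rw [mem_outer] at hi
    rw [mem_leviPos]
    exact fun h => hi.ne' h.2

omit [P.IsCrystallographic] in
theorem two_mul_rho_sub (v : V) : 2 * P.toLinearMap v (rho b - rhoCheck b J) =
    ∑ i ∈ outer b J, P.toLinearMap v (P.coroot i) := by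
  rw [map_sub, mul_sub, two_mul_rhoCheck b hJ, rho, two_mul_rhoCheck b subset_rfl,
    leviPos_support, sum_outer_empty b hJ]
  ring

theorem two_mul_rho_sub_root (γ : ι) :
    2 * P.toLinearMap (P.root γ) (rho b - rhoCheck b J) = rhoPairing b J γ := by
  rw [two_mul_rho_sub b hJ, rhoPairing, Int.cast_sum]
  refine Finset.sum_congr rfl fun i _ => ?_
  rw [root_coroot_eq_pairing, ← P.algebraMap_pairingIn ℤ]; rfl

/-- By `PetCond`, `⟨α^∨, ξ⟩` is `-1` or `0` for `α ∈ Δ_J⁺`, according to whether `g` makes `α`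
negative or not. So `2⟨ρ_J^∨, ξ⟩` cancels the inversions of `g` in `Δ_J`. -/
theorem isSiLen_iff [P.IsReduced] {g : P.Aut} (hg : g ∈ P.weylGroup) {ξ : V} (hξ : ξ ∈ Q P)
    (hP : PetCond b J g ξ) (m : ℝ) : IsSiLen b (emb P g * t P ξ) m ↔
      m = invCount b J g + 2 * P.toLinearMap ξ (rho b - rhoCheck b J) := by
  have h1 : (len b (emb P g) : ℝ) + 2 * P.toLinearMap ξ (rho b) =
      invCount b J g + 2 * P.toLinearMap ξ (rho b - rhoCheck b J) := by
    have h2 : (len b (emb P g) : ℝ) = (invCount b ∅ g : ℝ) := by exact_mod_cast len_emb b hg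
    rw [h2, invCount_empty_eq b hJ, map_sub, mul_sub, two_mul_rhoCheck b hJ]
    have h3 : ∑ i ∈ leviPos b J, P.toLinearMap ξ (P.coroot i) =
        -∑ i ∈ leviPos b J, (negInd b (g • i) : ℝ) := by
      rw [← Finset.sum_neg_distrib]
      refine Finset.sum_congr rfl fun i hi => ?_
      rw [mem_leviPos] at hi
      rw [hP i hi.2, negInd_of_isPos b hi.1]
      push_cast; ring
    rw [h3]; push_cast; ring
  rw [← h1]
  constructor
  · rintro ⟨w, hw, ζ, hζ, h4, rfl⟩
    obtain ⟨h, hh, rfl⟩ := mem_W_iff.1 hw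
    obtain ⟨rfl, rfl⟩ := emb_mul_t_inj h4
    rfl
  · rintro rfl
    exact ⟨_, emb_mem_W hg, ξ, hξ, rfl, rfl⟩

theorem siEdge_iff [P.IsReduced] {g : P.Aut} (hg : g ∈ P.weylGroup) {ξ : V} (hξ : ξ ∈ Q P)
    (γ : ι) (n : ℤ) (y : AffWt V ≃ₗ[ℝ] AffWt V) :
    SiEdge b J (g • γ) n (emb P g * t P ξ) y ↔
      emb P g * t P ξ ∈ Waf P ∧ PetCond b J g ξ ∧
      y = emb P (g * Equiv.reflection P γ) * t P (ξ + (n : ℝ) • P.root γ) ∧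
      PetCond b J (g * Equiv.reflection P γ) (ξ + (n : ℝ) • P.root γ) ∧
      negInd b (g • γ) ≤ n ∧
      invCount b J (g * Equiv.reflection P γ) - invCount b J g + n * rhoPairing b J γ = 1 := by
  have hg' := mul_mem hg (P.reflection_mem_weylGroup γ)
  have hξ' := add_mem hξ (intCast_smul_root_mem_Q (P := P) n γ)
  have hlen : (invCount b J (g * Equiv.reflection P γ) : ℝ) +
        2 * P.toLinearMap (ξ + (n : ℝ) • P.root γ) (rho b - rhoCheck b J) =
      invCount b J g + 2 * P.toLinearMap ξ (rho b - rhoCheck b J) + 1 ↔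
      invCount b J (g * Equiv.reflection P γ) - invCount b J g + n * rhoPairing b J γ = 1 := by
    rw [map_add, map_smul, LinearMap.add_apply, LinearMap.smul_apply, smul_eq_mul, mul_add,
      mul_left_comm, two_mul_rho_sub_root b hJ]
    constructor
    · intro h
      have : ((invCount b J (g * Equiv.reflection P γ) - invCount b J g +
        n * rhoPairing b J γ : ℤ) : ℝ) = (1 : ℤ) := by push_cast; linarith
      exact_mod_cast this
    · intro h
      have : ((invCount b J (g * Equiv.reflection P γ) - invCount b J g +
        n * rhoPairing b J γ : ℤ) : ℝ) = (1 : ℤ) := by rw [h]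
      push_cast at this; linarith
  unfold SiEdge
  rw [s_mul_emb_mul_t, mem_Pet_iff b hJ hξ, affPos_iff]
  constructor
  · rintro ⟨⟨h1, h2⟩, h3, h4, rfl, m, h5, h6⟩
    have h7 := ((mem_Pet_iff b hJ hξ').1 h3).2
    rw [isSiLen_iff b hJ hg hξ h2] at h5
    rw [isSiLen_iff b hJ hg' hξ' h7, h5] at h6
    exact ⟨h1, h2, rfl, h7, h4, hlen.1 h6.symm⟩
  · rintro ⟨h1, h2, rfl, h3, h4, h5⟩
    refine ⟨⟨h1, h2⟩, (mem_Pet_iff b hJ hξ').2 ⟨?_, h3⟩, h4, rfl, _,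
      (isSiLen_iff b hJ hg hξ h2 _).2 rfl, (isSiLen_iff b hJ hg' hξ' h3 _).2 (hlen.2 h5).symm⟩
    rw [← s_mul_emb_mul_t]
    exact mul_mem (s_mem_Waf _ _) h1

end Peterson

/-! ### Projection and lifting of edges between the two graphs. -/

section Edges

variable {ι V N : Type*} [Fintype ι] [AddCommGroup V] [Module ℝ V] [AddCommGroup N] [Module ℝ N]
  {P : RootPairing ι ℝ V N} [P.IsCrystallographic] [P.IsRootSystem]
  (b : P.Base) {J : Set ι} (hJ : J ⊆ b.support)

omit [Fintype ι] [P.IsCrystallographic] [P.IsRootSystem] in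
theorem reflection_reflectionPerm_self (γ : ι) :
    Equiv.reflection P (P.reflectionPerm γ γ) = Equiv.reflection P γ := by
  rw [← reflection_smul_index, ← conj_reflection, mul_inv_cancel_right]

theorem rhoPairing_neg (γ : ι) :
    rhoPairing b J (P.reflectionPerm γ γ) = -rhoPairing b J γ := by
  unfold rhoPairing
  rw [← Finset.sum_neg_distrib]
  refine Finset.sum_congr rfl fun i _ => ?_
  have : P.pairing (P.reflectionPerm γ γ) i = - P.pairing γ i := by
    rw [pairing_reflectionPerm_self_left]
  rw [← P.algebraMap_pairingIn ℤ, ← P.algebraMap_pairingIn ℤ] at this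
  have h : ((P.pairingIn ℤ (P.reflectionPerm γ γ) i : ℤ) : ℝ) = -(P.pairingIn ℤ γ i : ℤ) := by
    simp
  exact_mod_cast h

/-- An edge of the semi-infinite Bruhat graph is either a Bruhat edge or a quantum edge. -/
theorem bruhat_or_quantum (g : P.Aut) (γ : ι) {n : ℤ} (hn : negInd b (g • γ) ≤ n)
    (h : invCount b J (g * Equiv.reflection P γ) - invCount b J g + n * rhoPairing b J γ = 1) :
    0 < offHeight b J (P.root γ) ∧
      (invCount b J (g * Equiv.reflection P γ) - invCount b J g = 1 ∨
        invCount b J (g * Equiv.reflection P γ) - invCount b J g = 1 - rhoPairing b J γ) := by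
  have hn0 : 0 ≤ n := (negInd_mem b (g • γ)).1.trans hn
  rcases lt_trichotomy (offHeight b J (P.root γ)) 0 with hγ | hγ | hγ
  -- A negative `γ` outside `Δ_J` is impossible: the bounds for `-γ` give `D ≤ -1` if `n = 0`, and
  -- `D ≤ -R - 1` with `R ≤ -2` if `n ≥ 1`, so `D + nR < 0` in both cases.
  · exfalso
    have hγ' : 0 < offHeight b J (P.root (P.reflectionPerm γ γ)) := by
      rw [root_reflectionPerm_self, map_neg]; linarith
    rcases hn0.eq_or_lt with rfl | hn1
    · have h1 : b.IsPos (g • γ) := by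
        rw [← negInd_eq_zero_iff]; exact le_antisymm hn (negInd_mem b _).1
      have h2 := invCount_mul_reflection_neg b J hγ' g (by
        rw [smul_reflectionPerm_self, isPos_reflectionPerm_self]; exact not_not.2 h1)
      rw [reflection_reflectionPerm_self] at h2
      linarith
    · have h1 := rhoPairing_upper b J hγ' g
      have h2 := two_le_rhoPairing b J hγ'
      rw [rhoPairing_neg] at h1 h2
      rw [reflection_reflectionPerm_self] at h1
      nlinarith
  -- For `γ ∈ Δ_J` both `D` and `R` vanish, which contradicts `D + nR = 1`.
  · exfalso
    rw [rhoPairing_eq_zero b J hγ, invCount_mul_of_preserves] at h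
    · linarith
    · intro v
      rw [Equiv.reflection_smul, reflection_apply, map_sub, LinearMap.map_smul, hγ, smul_zero,
        sub_zero]
  · refine ⟨hγ, ?_⟩
    rcases hn0.eq_or_lt with rfl | hn1
    · left; linarith
    · right
      have h1 := rhoPairing_lower b J hγ g
      have h2 := two_le_rhoPairing b J hγ
      -- From `D ≥ 1 - R` one gets `1 ≥ 1 + (n - 1)R`, and `R ≥ 2`.
      have h3 : n = 1 := by
        by_contra hne
        have : 2 ≤ n := by omega
        nlinarith
      rw [h3] at h; linarith

/-- An edge of the quantum Bruhat graph lifts to the semi-infinite Bruhat graph. -/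
theorem exists_petCond_of_edge (g : P.Aut) {ξ : V} (hP : PetCond b J g ξ) {γ : ι}
    (hγ : 0 < offHeight b J (P.root γ))
    (h : invCount b J (g * Equiv.reflection P γ) - invCount b J g = 1 ∨
        invCount b J (g * Equiv.reflection P γ) - invCount b J g = 1 - rhoPairing b J γ) :
    ∃ n : ℤ, PetCond b J (g * Equiv.reflection P γ) (ξ + (n : ℝ) • P.root γ) ∧
      negInd b (g • γ) ≤ n ∧
      invCount b J (g * Equiv.reflection P γ) - invCount b J g + n * rhoPairing b J γ = 1 := by
  -- Subtracting the condition for `(g, ξ)` from the one for `(g s_γ, ξ + nγ)` leaves an identity in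
  -- signs and pairings, free of `ξ`.
  have key (n : ℤ) (hn : ∀ i, offHeight b J (P.root i) = 0 →
      n * P.pairingIn ℤ γ i = negInd b (g • i) - negInd b (g • P.reflectionPerm γ i)) :
      PetCond b J (g * Equiv.reflection P γ) (ξ + (n : ℝ) • P.root γ) := by
    intro i hi
    have h1 : ((n * P.pairingIn ℤ γ i : ℤ) : ℝ) = _ := congrArg _ (hn i hi)
    rw [map_add, map_smul, LinearMap.add_apply, LinearMap.smul_apply, hP i hi,
      root_coroot_eq_pairing, ← P.algebraMap_pairingIn ℤ, mul_smul, reflection_smul_index]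
    push_cast at h1 ⊢
    change _ + (n : ℝ) * (P.pairingIn ℤ γ i : ℝ) = _
    linarith
  have hfix (i : ι) (h0 : P.pairing i γ = 0) : P.reflectionPerm γ i = i := by
    apply P.root.injective
    rw [root_reflectionPerm', h0, zero_smul, sub_zero]
  have hneg (i : ι) : P.reflectionPerm γ (P.reflectionPerm i i) =
      P.reflectionPerm (P.reflectionPerm γ i) (P.reflectionPerm γ i) := by
    have := smul_reflectionPerm_self (Equiv.reflection P γ) i
    simpa only [reflection_smul_index] using this
  rcases h with h | h
  · have hpos : b.IsPos (g • γ) := by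
      by_contra hc
      have := invCount_mul_reflection_neg b J hγ g hc
      linarith
    refine ⟨0, key 0 fun i hi => ?_, (negInd_of_isPos b hpos).le, by rw [h]; ring⟩
    -- The identity in `key` is the vanishing of an odd function on `s_γ Δ_J`. It vanishes on
    -- `outerDrop` away from `γ` by the equality case of the length bound, here and in the quantum
    -- case below.
    have := eq_zero_of_odd b J hγ
      (fun i => negInd b (g • P.reflectionPerm γ i) - negInd b (g • i)) ?_ ?_ ?_ hi
    · simp only [reflectionPerm_self] at this
      linarith
    · intro i
      simp only [hneg, negInd_smul_neg]; ring
    · intro i hi hne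
      exact sub_eq_zero.2 (negInd_eq_of_invCount_eq_one b J hγ g hpos h hi hne)
    · intro i h0
      simp only [hfix i h0, sub_self]
  · refine ⟨1, key 1 fun i hi => ?_, (negInd_mem b _).2, by rw [h]; ring⟩
    have := eq_zero_of_odd b J hγ
      (fun i => negInd b (g • P.reflectionPerm γ i) - negInd b (g • i) + P.pairingIn ℤ γ i)
      ?_ ?_ ?_ hi
    · simp only [reflectionPerm_self, pairingIn_reflectionPerm] at this
      linarith
    · intro i
      have h1 : P.pairingIn ℤ γ (P.reflectionPerm i i) = -P.pairingIn ℤ γ i := by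
        have : P.pairing γ (P.reflectionPerm i i) = - P.pairing γ i := by
          rw [pairing_reflectionPerm_self_right]
        rw [← P.algebraMap_pairingIn ℤ, ← P.algebraMap_pairingIn ℤ] at this
        have h : ((P.pairingIn ℤ γ (P.reflectionPerm i i) : ℤ) : ℝ) =
          -(P.pairingIn ℤ γ i : ℤ) := by simp
        exact_mod_cast h
      simp only [hneg, negInd_smul_neg, h1]; ring
    · intro i hi hne
      obtain ⟨h1, h2⟩ := of_invCount_eq_rhoPairing b J hγ g h hi hne
      rw [h1, h2]; norm_num
    · intro i h0
      have h1 : P.pairing γ i = 0 := P.pairing_eq_zero_iff.1 h0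
      rw [← P.algebraMap_pairingIn ℤ] at h1
      have h2 : P.pairingIn ℤ γ i = 0 := by simpa using h1
      simp only [hfix i h0, sub_self, h2, add_zero]

variable [P.IsReduced]
include hJ

/-- The minimal representative `g` preserves signs on `Δ_J`, so the Peterson condition for `k t_ξ`
passes to `gk t_ξ`. -/
theorem exists_of_isDecomp {x w : AffWt V ≃ₗ[ℝ] AffWt V} {ξ : V} (h : IsDecomp b J x w ξ) :
    ∃ g ∈ P.weylGroup, KeepsPos b J g ∧ emb P g = w ∧
      ∃ k ∈ Subgroup.closure (Equiv.reflection P '' J),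
        x = emb P (g * k) * t P ξ ∧ PetCond b J (g * k) ξ ∧ x ∈ Waf P := by
  obtain ⟨hw, ⟨hξ, -⟩, z, ⟨hz, hzP⟩, rfl⟩ := h
  obtain ⟨g, hg, rfl, hgk⟩ := keepsPos_of_mem_WUp b hJ hw
  obtain ⟨k, hk, rfl⟩ := mem_WJ hz
  refine ⟨g, hg, hgk, rfl, k, hk, by rw [map_mul], fun i hi => ?_, ?_⟩
  · rw [((mem_Pet_iff b hJ hξ).1 hzP).2 i hi, mul_smul, hgk.negInd_smul]
    rw [root_smul, offHeight_parabolic b hJ hk, hi]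
  · rw [mul_assoc]
    exact mul_mem (W_le_Waf (emb_mem_W hg)) hzP.1

/-- That `ξ` is `J`-adjusted is automatic: on `Δ_J⁺` the Peterson condition leaves only the values
`0` and `-1`. -/
theorem isDecomp_of_petCond {g k : P.Aut} {ξ : V} (hw : emb P g ∈ WUp b J)
    (hk : k ∈ Subgroup.closure (Equiv.reflection P '' J)) (hkJ : emb P k ∈ WJ P J) (hξ : ξ ∈ Q P)
    (hx : emb P (g * k) * t P ξ ∈ Waf P) (hP : PetCond b J (g * k) ξ) :
    IsDecomp b J (emb P (g * k) * t P ξ) (emb P g) ξ := by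
  obtain ⟨g', hg, hgg, hgk⟩ := keepsPos_of_mem_WUp b hJ hw
  obtain rfl := emb_injective hgg
  refine ⟨hw, ⟨hξ, fun i hi hiJ => ?_⟩, emb P k, ⟨hkJ, (mem_Pet_iff b hJ hξ).2 ⟨?_, ?_⟩⟩,
    by rw [map_mul]⟩
  · rw [hP i ((inJ_iff b hJ i).1 hiJ), negInd_of_isPos b hi]
    by_cases h : b.IsPos ((g' * k) • i)
    · left; rw [negInd_of_isPos b h]; simp
    · right; rw [negInd_of_not_isPos b h]; simp
  · rw [map_mul, mul_assoc] at hx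
    exact (Subgroup.mul_mem_cancel_left _ (W_le_Waf (emb_mem_W hg))).1 hx
  · intro i hi
    rw [hP i hi, mul_smul, hgk.negInd_smul]
    rw [root_smul, offHeight_parabolic b hJ hk, hi]

theorem isDecomp_unique {x w w' : AffWt V ≃ₗ[ℝ] AffWt V} {ξ ξ' : V} (h : IsDecomp b J x w ξ)
    (h' : IsDecomp b J x w' ξ') : w = w' ∧ ξ = ξ' := by
  obtain ⟨g, hg, hgJ, rfl, k, hk, rfl, -, -⟩ := exists_of_isDecomp b hJ h
  obtain ⟨g', hg', hgJ', rfl, k', hk', h2, -, -⟩ := exists_of_isDecomp b hJ h'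
  obtain ⟨h3, rfl⟩ := emb_mul_t_inj h2
  have h4 : g = g' * (k' * k⁻¹) := by rw [← mul_assoc, ← h3, mul_inv_cancel_right]
  have h5 := floor_unique b hJ hgJ' (h4 ▸ hgJ) (mul_mem hk' (inv_mem hk))
  rw [h5, mul_one] at h4
  exact ⟨by rw [h4], rfl⟩

theorem exists_isDecomp {x : AffWt V ≃ₗ[ℝ] AffWt V} (hx : x ∈ Pet b J) :
    ∃ w ξ, IsDecomp b J x w ξ := by
  obtain ⟨g, hg, ξ, hξ, rfl, hP⟩ := exists_of_mem_Pet b hJ hx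
  obtain ⟨v, hv, u, hu, h⟩ := exists_floor b (J := J) (emb_mem_W hg) WJ_le_W
  obtain ⟨g', hg', rfl, hgJ⟩ := keepsPos_of_mem_WUp b hJ hv
  obtain ⟨k, hk, rfl⟩ := mem_WJ hu
  rw [← map_mul] at h
  obtain rfl := emb_injective h
  exact ⟨_, _, isDecomp_of_petCond b hJ hv hk hu hξ hx.1 hP⟩

theorem isDecomp_self {w : AffWt V ≃ₗ[ℝ] AffWt V} (hw : w ∈ WUp b J) : IsDecomp b J w w 0 := by
  obtain ⟨g, hg, rfl, hgJ⟩ := keepsPos_of_mem_WUp b hJ hw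
  have h := isDecomp_of_petCond b hJ (k := 1) (ξ := 0) hw (one_mem _) (by rw [map_one]; exact one_mem _)
    (zero_mem _) ?_ ?_
  · rwa [mul_one, t_zero, mul_one] at h
  · rw [mul_one, t_zero, mul_one]; exact W_le_Waf (emb_mem_W hg)
  · intro i hi
    rw [mul_one, hgJ.negInd_smul b hi]; simp

theorem mem_Pet_of_isDecomp {x w : AffWt V ≃ₗ[ℝ] AffWt V} {ξ : V} (h : IsDecomp b J x w ξ) :
    x ∈ Pet b J := by
  obtain ⟨g, hg, hgJ, rfl, k, hk, rfl, hP, hW⟩ := exists_of_isDecomp b hJ h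
  exact (mem_Pet_iff b hJ h.2.1.1).2 ⟨hW, hP⟩

omit hJ [P.IsCrystallographic] [P.IsRootSystem] [P.IsReduced] in
-- At level zero the translation only changes the `δ`-coefficient, which a real coroot does not see,
-- and `K` pairs to zero. Hence `ξ` and `n` play no role in the integrality condition.
theorem affPairing_emb_mul_t (g : P.Aut) (ξ : V) {lam : AffWt V} (h0 : lam.2.2 = 0) (γ : ι)
    (n : ℤ) : affPairing P ((emb P g * t P ξ) lam) (affCoroot P (g • γ) n) =
      P.toLinearMap lam.1 (P.coroot γ) := by
  rw [LinearEquiv.mul_apply, emb_apply, t_apply, affPairing_apply]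
  simp only [h0, affCoroot, zero_smul, add_zero, zero_mul, mul_zero]
  exact toLinearMap_smul_coroot g lam.1 γ

omit hJ [Fintype ι] [P.IsCrystallographic] [P.IsRootSystem] [P.IsReduced] in
theorem toLinearMap_coroot_parabolic {k : P.Aut}
    (hk : k ∈ Subgroup.closure (Equiv.reflection P '' J)) {v : V}
    (hv : ∀ j ∈ J, P.toLinearMap v (P.coroot j) = 0) (γ : ι) :
    P.toLinearMap v (P.coroot (k • γ)) = P.toLinearMap v (P.coroot γ) := by
  nth_rw 1 [← parabolic_smul hk v hv]
  exact toLinearMap_smul_coroot k v γ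

omit [P.IsCrystallographic] [P.IsReduced] in
-- Passes between the vertex `gk t_ξ` with label `gkγ` and the vertex `g` of `QBG^J` with label
-- `kγ`.
theorem invCount_mul_reflection_parabolic {g h k u : P.Aut} {γ : ι}
    (hk : k ∈ Subgroup.closure (Equiv.reflection P '' J))
    (hu : u ∈ Subgroup.closure (Equiv.reflection P '' J))
    (H : g * Equiv.reflection P (k • γ) = h * u) :
    invCount b J (g * k * Equiv.reflection P γ) = invCount b J h := by
  rw [mul_assoc, mul_reflection, ← mul_assoc, H,
    invCount_mul_of_preserves _ _ _ _ (offHeight_parabolic b hJ hk),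
    invCount_mul_of_preserves _ _ _ _ (offHeight_parabolic b hJ hu)]

omit [P.IsReduced] in
theorem rhoPairing_parabolic {k : P.Aut}
    (hk : k ∈ Subgroup.closure (Equiv.reflection P '' J)) (γ : ι) :
    rhoPairing b J (k • γ) = rhoPairing b J γ := by
  have hphi := offHeight_parabolic b hJ hk
  have hphi' := offHeight_parabolic b hJ (inv_mem hk)
  refine Finset.sum_nbij' (k⁻¹ • ·) (k • ·) ?_ ?_ ?_ ?_ ?_
  · intro i hi; rw [mem_outer] at hi ⊢; rwa [root_smul, hphi']
  · intro i hi; rw [mem_outer] at hi ⊢; rwa [root_smul, hphi]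
  · intro i _; simp
  · intro i _; simp
  · intro i _
    have := pairing_smul_smul k⁻¹ (k • γ) i
    rw [inv_smul_smul] at this
    rw [← P.algebraMap_pairingIn ℤ, ← P.algebraMap_pairingIn ℤ] at this
    have h : (P.pairingIn ℤ γ (k⁻¹ • i) : ℝ) = P.pairingIn ℤ (k • γ) i := by simpa using this
    exact_mod_cast h.symm

/-- If `x = gk t_ξ` and the finite part of the affine label is `gkγ`, the edge below has label `kγ`;
the two alternatives of `bruhat_or_quantum` become the two length conditions of `QEdge`. -/
theorem exists_qEdge_of_siEdge {x y w v : AffWt V ≃ₗ[ℝ] AffWt V} {ξ ζ : V} {δ : ι} {n : ℤ}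
    (hE : SiEdge b J δ n x y) (hx : IsDecomp b J x w ξ) (hy : IsDecomp b J y v ζ)
    {lam : AffWt V} (h0 : lam.2.2 = 0) (hlam : ∀ j ∈ J, P.toLinearMap lam.1 (P.coroot j) = 0) :
    ∃ γ, QEdge b J γ w v ∧
      P.toLinearMap lam.1 (P.coroot γ) = affPairing P (x lam) (affCoroot P δ n) := by
  obtain ⟨g, hg, hgJ, rfl, k, hk, rfl, -, -⟩ := exists_of_isDecomp b hJ hx
  obtain ⟨h, hh, hhJ, rfl, u, hu, rfl, -, -⟩ := exists_of_isDecomp b hJ hy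
  have hkW := parabolic_le_weylGroup J hk
  obtain ⟨γ, rfl⟩ : ∃ γ, δ = (g * k) • γ := ⟨(g * k)⁻¹ • δ, by rw [smul_inv_smul]⟩
  obtain ⟨-, -, h1, -, h2, h3⟩ := (siEdge_iff b hJ (mul_mem hg hkW) hx.2.1.1 γ n _).1 hE
  obtain ⟨h4, -⟩ := emb_mul_t_inj h1
  obtain ⟨h5, h6⟩ := bruhat_or_quantum b _ γ h2 h3
  have h7 : g * Equiv.reflection P (k • γ) = h * (u * k⁻¹) := by
    rw [← mul_assoc, h4, mul_assoc g, mul_reflection k γ, ← mul_assoc, mul_inv_cancel_right]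
  have hu' := mul_mem hu (inv_mem hk)
  have h8 := invCount_mul_reflection_parabolic b hJ hk hu' h7
  rw [h8, invCount_mul_of_preserves _ _ g _ (offHeight_parabolic b hJ hk)] at h6
  have h9 : 0 < offHeight b J (P.root (k • γ)) := by
    rwa [root_smul, offHeight_parabolic b hJ hk]
  obtain ⟨h10, h11⟩ := (isPos_and_not_inJ_iff b hJ _).2 h9
  obtain ⟨hw, -, z, ⟨hz, -⟩, hz2⟩ := hx
  obtain ⟨hv, -, z', ⟨hz', -⟩, hz2'⟩ := hy
  have hzk : emb P k = z := by
    rw [map_mul] at hz2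
    exact mul_left_cancel (mul_right_cancel hz2)
  have hzu : emb P u = z' := by
    rw [map_mul] at hz2'
    exact mul_left_cancel (mul_right_cancel hz2')
  refine ⟨k • γ, ⟨hw, hv, h10, h11, ⟨hv, emb P (u * k⁻¹), ?_, ?_⟩, ?_⟩, ?_⟩
  · rw [map_mul, map_inv, hzk, hzu]
    exact mul_mem hz' (inv_mem hz)
  · rw [s_zero_eq, ← map_mul, ← map_mul, h7]
  · rw [two_mul_rho_sub_root b hJ, rhoPairing_parabolic b hJ hk]
    have e1 : (len b (emb P g) : ℝ) = invCount b J g := by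
      exact_mod_cast len_of_keepsPos b hJ hg hgJ
    have e2 : (len b (emb P h) : ℝ) = invCount b J h := by
      exact_mod_cast len_of_keepsPos b hJ hh hhJ
    rw [e1, e2]
    rcases h6 with h6 | h6
    · left
      have : (invCount b J h : ℝ) - invCount b J g = 1 := by exact_mod_cast h6
      linarith
    · right
      have : (invCount b J h : ℝ) - invCount b J g = 1 - rhoPairing b J γ := by exact_mod_cast h6
      linarith
  · rw [affPairing_emb_mul_t _ _ h0, toLinearMap_coroot_parabolic hk hlam]

/-- The lift `x` of the source is arbitrary, so that edges can be lifted one after another along a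
chain and from one entry of a path to the next. -/
theorem exists_siEdge_of_qEdge {x w v : AffWt V ≃ₗ[ℝ] AffWt V} {ξ : V} {γ : ι}
    (hE : QEdge b J γ w v) (hx : IsDecomp b J x w ξ)
    {lam : AffWt V} (h0 : lam.2.2 = 0) (hlam : ∀ j ∈ J, P.toLinearMap lam.1 (P.coroot j) = 0) :
    ∃ y ζ δ n, SiEdge b J δ n x y ∧ IsDecomp b J y v ζ ∧
      affPairing P (x lam) (affCoroot P δ n) = P.toLinearMap lam.1 (P.coroot γ) := by
  obtain ⟨hw, hv, hpos, hJγ, ⟨-, u, hu, hfl⟩, hlen⟩ := hE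
  have hx' := hx
  obtain ⟨g, hg, hgJ, rfl, k, hk, rfl, hP, hW⟩ := exists_of_isDecomp b hJ hx
  obtain ⟨h, hh, rfl, hhJ⟩ := keepsPos_of_mem_WUp b hJ hv
  obtain ⟨u, hu', rfl⟩ := mem_WJ hu
  obtain ⟨-, -, z, ⟨hz, -⟩, hz2⟩ := hx'
  have hzk : emb P k = z := by
    rw [map_mul] at hz2
    exact mul_left_cancel (mul_right_cancel hz2)
  have hkW := parabolic_le_weylGroup J hk
  obtain ⟨γ, rfl⟩ : ∃ γ', γ = k • γ' := ⟨k⁻¹ • γ, by rw [smul_inv_smul]⟩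
  have h7 : g * Equiv.reflection P (k • γ) = h * u := by
    rw [s_zero_eq, ← map_mul, ← map_mul] at hfl
    exact emb_injective hfl
  have hγ : 0 < offHeight b J (P.root γ) := by
    rw [← offHeight_parabolic b hJ hk, ← root_smul]
    exact (isPos_and_not_inJ_iff b hJ _).1 ⟨hpos, hJγ⟩
  have h8 := invCount_mul_reflection_parabolic b hJ hk hu' h7
  have h9 := invCount_mul_of_preserves b J g k (offHeight_parabolic b hJ hk)
  have h6 : invCount b J (g * k * Equiv.reflection P γ) - invCount b J (g * k) = 1 ∨
      invCount b J (g * k * Equiv.reflection P γ) - invCount b J (g * k) =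
        1 - rhoPairing b J γ := by
    rw [h8, h9]
    rw [two_mul_rho_sub_root b hJ, rhoPairing_parabolic b hJ hk] at hlen
    have e1 : (len b (emb P g) : ℝ) = invCount b J g := by
      exact_mod_cast len_of_keepsPos b hJ hg hgJ
    have e2 : (len b (emb P h) : ℝ) = invCount b J h := by
      exact_mod_cast len_of_keepsPos b hJ hh hhJ
    rw [e1, e2] at hlen
    rcases hlen with hl | hl
    · left
      have : (invCount b J h : ℝ) - invCount b J g = 1 := by linarith
      exact_mod_cast this
    · right
      have : (invCount b J h : ℝ) - invCount b J g = 1 - rhoPairing b J γ := by linarith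
      exact_mod_cast this
  obtain ⟨n, hP', hn, hdiff⟩ := exists_petCond_of_edge b (g * k) hP hγ h6
  have hξ := hx.2.1.1
  have hE := (siEdge_iff b hJ (mul_mem hg hkW) hξ γ n _).2 ⟨hW, hP, rfl, hP', hn, hdiff⟩
  have h10 : g * k * Equiv.reflection P γ = h * (u * k) := by
    rw [mul_assoc, mul_reflection, ← mul_assoc, h7, mul_assoc]
  refine ⟨_, ξ + (n : ℝ) • P.root γ, _, n, hE, ?_, ?_⟩
  · have hW' := hE.2.1.1
    rw [h10] at hP' hW' ⊢
    refine isDecomp_of_petCond b hJ hv (mul_mem hu' hk) ?_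
      (add_mem hξ (intCast_smul_root_mem_Q n γ)) hW' hP'
    rw [map_mul, hzk]
    exact mul_mem hu hz
  · rw [affPairing_emb_mul_t _ _ h0, toLinearMap_coroot_parabolic hk hlam]

end Edges

end

end DualUntwisted

namespace DualUntwisted

/-! ### Paths as lists: deletion of repetitions, lifting and projection. -/

section Lists

variable {X Y : Type*}

theorem merge_cons_cons_of_ne {p q : X × ℚ} {l : List (X × ℚ)} (h : p.1 ≠ q.1) :
    merge (p :: q :: l) = p :: merge (q :: l) := by
  rw [merge, if_neg h]

theorem merge_cons_cons_of_eq {p q : X × ℚ} {l : List (X × ℚ)} (h : p.1 = q.1) :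
    merge (p :: q :: l) = merge (q :: l) := by
  rw [merge, if_pos h]

theorem exists_merge_cons (p : X × ℚ) (l : List (X × ℚ)) :
    ∃ q l', merge (p :: l) = q :: l' ∧ q.1 = p.1 := by
  induction l generalizing p with
  | nil => exact ⟨p, [], by rw [merge], rfl⟩
  | cons q l ih =>
    by_cases h : p.1 = q.1
    · obtain ⟨r, l', h1, h2⟩ := ih q
      exact ⟨r, l', by rw [merge_cons_cons_of_eq h, h1], h2.trans h.symm⟩
    · exact ⟨p, _, merge_cons_cons_of_ne h, rfl⟩

theorem mem_of_mem_merge {p : X × ℚ} {l : List (X × ℚ)} (h : p ∈ merge l) : p ∈ l := by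
  induction l with
  | nil => rw [merge] at h; exact h
  | cons q l ih =>
    cases l with
    | nil => rw [merge] at h; exact h
    | cons r l =>
      by_cases hq : q.1 = r.1
      · rw [merge_cons_cons_of_eq hq] at h
        exact List.mem_cons_of_mem _ (ih h)
      · rw [merge_cons_cons_of_ne hq] at h
        rcases List.mem_cons.1 h with rfl | h
        · exact List.mem_cons_self
        · exact List.mem_cons_of_mem _ (ih h)

theorem getLast?_merge (l : List (X × ℚ)) : (merge l).getLast? = l.getLast? := by
  induction l with
  | nil => rw [merge]
  | cons q l ih =>
    cases l with
    | nil => rw [merge]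
    | cons r l =>
      by_cases hq : q.1 = r.1
      · rw [merge_cons_cons_of_eq hq, ih, List.getLast?_cons_cons]
      · obtain ⟨q', l', h1, -⟩ := exists_merge_cons r l
        rw [merge_cons_cons_of_ne hq, List.getLast?_cons_cons, ← ih, h1, List.getLast?_cons_cons]

theorem isChain_merge (C : ℚ → X → X → Prop) {l : List (X × ℚ)}
    (h : l.IsChain fun p q => p.2 < q.2 ∧ C p.2 q.1 p.1) :
    (merge l).IsChain fun p q => p.2 < q.2 ∧ p.1 ≠ q.1 ∧ C p.2 q.1 p.1 := by
  -- Merging a block of equal entries keeps the last one, whose rational number is the largest. The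
  -- second clause records this, so that the strict increase survives at the join.
  suffices H : (merge l).IsChain (fun p q => p.2 < q.2 ∧ p.1 ≠ q.1 ∧ C p.2 q.1 p.1) ∧
      ∀ p ∈ l.head?, ∀ q ∈ (merge l).head?, p.2 ≤ q.2 from H.1
  induction l with
  | nil => rw [merge]; simp
  | cons p l ih =>
    cases l with
    | nil => rw [merge]; simp
    | cons q l =>
      rw [List.isChain_cons_cons] at h
      obtain ⟨ih1, ih2⟩ := ih h.2
      obtain ⟨r, l', h1, h2⟩ := exists_merge_cons q l
      have hqr : q.2 ≤ r.2 := ih2 q (by simp) r (by rw [h1]; simp)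
      by_cases hpq : p.1 = q.1
      · rw [merge_cons_cons_of_eq hpq]
        refine ⟨ih1, fun p' hp' q' hq' => ?_⟩
        rw [List.head?_cons, Option.mem_some] at hp'
        rw [h1, List.head?_cons, Option.mem_some] at hq'
        subst hp' hq'
        exact h.1.1.le.trans hqr
      · rw [merge_cons_cons_of_ne hpq, h1, List.isChain_cons_cons]
        rw [h1] at ih1
        refine ⟨⟨⟨h.1.1.trans_le hqr, h2 ▸ hpq, h2 ▸ h.1.2⟩, ih1⟩, fun p' hp' q' hq' => ?_⟩
        rw [List.head?_cons, Option.mem_some] at hp' hq'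
        rw [← hp', ← hq']

theorem merge_eq_self {l : List (X × ℚ)} (h : l.IsChain fun p q => p.1 ≠ q.1) : merge l = l := by
  induction l with
  | nil => rw [merge]
  | cons p l ih =>
    cases l with
    | nil => rw [merge]
    | cons q l =>
      rw [List.isChain_cons_cons] at h
      rw [merge_cons_cons_of_ne h.1, ih h.2]

/-- A path over `Y` lifts to a path over `X` along a relation that lifts chains. -/
theorem exists_lift_isLSPath {S : Set X} {T : Set Y} {C : ℚ → X → X → Prop}
    {D : ℚ → Y → Y → Prop} {R : X → Y → Prop} (hfun : ∀ x y y', R x y → R x y' → y = y')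
    (hS : ∀ x y, R x y → x ∈ S) (hT : ∀ y ∈ T, ∃ x, R x y)
    (hD : ∀ a y y' x, R x y → D a y y' → ∃ x', R x' y' ∧ C a x x') {ζ : List (Y × ℚ)}
    (hζ : IsLSPath T D ζ) :
    ∃ η, IsLSPath S C η ∧ List.Forall₂ (fun p q => R p.1 q.1 ∧ p.2 = q.2) η ζ := by
  obtain ⟨h1, h2, h3⟩ := hζ
  unfold IsLSPath
  induction ζ with
  | nil => simp at h1
  | cons p l ih =>
    obtain ⟨y, hy⟩ := h1
    cases l with
    | nil =>
      rw [List.getLast?_singleton, Option.some_inj] at hy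
      subst hy
      obtain ⟨x, hx⟩ := hT _ (h2 _ List.mem_cons_self).1
      refine ⟨[(x, 1)], ⟨⟨x, rfl⟩, ?_, List.isChain_singleton _⟩,
        List.Forall₂.cons ⟨hx, rfl⟩ List.Forall₂.nil⟩
      intro p hp
      rw [List.mem_singleton] at hp
      subst hp
      exact ⟨hS _ _ hx, by norm_num, le_rfl⟩
    | cons q l =>
      rw [List.isChain_cons_cons] at h3
      rw [List.getLast?_cons_cons] at hy
      obtain ⟨η, ⟨⟨z, hz⟩, h5, h6⟩, h7⟩ := ih ⟨y, hy⟩ (fun r hr => h2 r (List.mem_cons_of_mem _ hr)) h3.2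
      cases h7 with
      | @cons q' _ η _ hq hη =>
        -- Chains run from the later entry to the earlier one, so the lift of the tail fixes the
        -- starting point and the endpoint is the new entry.
        obtain ⟨x', hx', hC⟩ := hD _ _ _ _ hq.1 h3.1.2.2
        refine ⟨(x', p.2) :: q' :: η, ⟨⟨z, by rw [List.getLast?_cons_cons]; exact hz⟩, ?_, ?_⟩,
          List.Forall₂.cons ⟨hx', rfl⟩ (List.Forall₂.cons hq hη)⟩
        · intro r hr
          rcases List.mem_cons.1 hr with rfl | hr
          · exact ⟨hS _ _ hx', (h2 p List.mem_cons_self).2⟩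
          · exact h5 r hr
        · rw [List.isChain_cons_cons]
          refine ⟨⟨by rw [hq.2]; exact h3.1.1, ?_, hC⟩, h6⟩
          intro heq
          apply h3.1.2.1
          change x' = q'.1 at heq
          rw [heq] at hx'
          exact hfun _ _ _ hx' hq.1

/-- Merging the image of a path under a map that sends chains to chains gives a path. -/
theorem isLSPath_merge_map {S : Set X} {T : Set Y} {C : ℚ → X → X → Prop}
    {D : ℚ → Y → Y → Prop} (f : X → Y) (hf : ∀ x ∈ S, f x ∈ T)
    (hC : ∀ a x x', C a x x' → D a (f x) (f x')) {η : List (X × ℚ)} (hη : IsLSPath S C η) :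
    IsLSPath T D (merge (η.map fun p => (f p.1, p.2))) := by
  obtain ⟨⟨x, hx⟩, h2, h3⟩ := hη
  refine ⟨⟨f x, ?_⟩, fun p hp => ?_, isChain_merge D ?_⟩
  · rw [getLast?_merge, List.getLast?_map, hx]; rfl
  · obtain ⟨q, hq, rfl⟩ := List.mem_map.1 (mem_of_mem_merge hp)
    exact ⟨hf _ (h2 q hq).1, (h2 q hq).2⟩
  · rw [List.isChain_map]
    exact h3.imp fun p q h => ⟨h.1, hC _ _ _ h.2.2⟩

end Lists

theorem Jaf_eq {ι V N : Type*} [AddCommGroup V] [Module ℝ V] [AddCommGroup N] [Module ℝ N]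
    {P : RootPairing ι ℝ V N} (b : P.Base) (lam : AffWt V) : Jaf b lam = J b (cl lam) := by
  ext i
  simp [Jaf, J, cl, affPairing_apply, affCoroot]

end DualUntwisted

/-! ### The projection of semi-infinite LS paths and its surjectivity. -/

theorem mainTheorem2 {ι V N : Type*} [Fintype ι] [AddCommGroup V] [Module ℝ V]
    [AddCommGroup N] [Module ℝ N] (P : RootPairing ι ℝ V N) [P.IsCrystallographic] [P.IsReduced]
    [P.IsIrreducible] (b : P.Base) (htwisted : ∃ i, DualUntwisted.c P i ≠ 1)
    (lam : DualUntwisted.AffWt V) (hlam : lam ∈ DualUntwisted.P0plus b) :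
    (∀ x ∈ DualUntwisted.Pet b (DualUntwisted.Jaf b lam),
      ∃! p : (DualUntwisted.AffWt V ≃ₗ[ℝ] DualUntwisted.AffWt V) × V,
        DualUntwisted.IsDecomp b (DualUntwisted.Jaf b lam) x p.1 p.2) ∧
    ∃ Φ : DualUntwisted.SiLS b lam → DualUntwisted.QLS b (DualUntwisted.cl lam),
      (∀ η ζ, DualUntwisted.Forgets b lam η.1 ζ → (Φ η).1 = DualUntwisted.merge ζ) ∧
      Function.Surjective Φ ∧
      ∀ ζ : DualUntwisted.QLS b (DualUntwisted.cl lam),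
        ∃ η, DualUntwisted.Forgets b lam η.1 ζ.1 ∧ Φ η = ζ := by
  classical
  open DualUntwisted in
  obtain ⟨i0, -⟩ := htwisted
  have : Nonempty ι := ⟨i0⟩
  have hJ : Jaf b lam ⊆ (b.support : Set ι) := fun i hi => hi.1
  have h0 : lam.2.2 = 0 := by simpa [affPairing_apply] using hlam.1
  have hlam0 : ∀ j ∈ Jaf b lam, P.toLinearMap lam.1 (P.coroot j) = 0 := by
    rw [Jaf_eq]; exact fun j hj => hj.2
  choose! proj wt hproj using fun x (hx : x ∈ Pet b (Jaf b lam)) => exists_isDecomp b hJ hx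
  have hQC (a : ℚ) (x x') (h : SiChain b lam a x x') : QChain b (cl lam) a (proj x) (proj x') := by
    refine Relation.ReflTransGen.lift proj ?_ _ _ h
    rintro x y ⟨δ, n, hE, k, hk⟩
    obtain ⟨γ, h1, h2⟩ :=
      exists_qEdge_of_siEdge b hJ hE (hproj x hE.1) (hproj y hE.2.1) h0 hlam0
    rw [Jaf_eq] at h1
    exact ⟨γ, h1, k, by rw [← hk, ← h2]; rfl⟩
  -- Uniqueness of the decomposition makes the forgetful relation a function, independent of the
  -- choice of `proj`.
  have hmap (η : SiLS b lam) (ζ) (h : Forgets b lam η.1 ζ) :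
      ζ = η.1.map fun p => (proj p.1, p.2) := by
    obtain ⟨η, hη⟩ := η
    have hmem := hη.2.1
    change Forgets b lam η ζ at h
    change ζ = η.map _
    clear hη
    induction h with
    | nil => rfl
    | @cons p q η ζ h1 _ ih =>
      obtain ⟨⟨ξ, h2⟩, h3⟩ := h1
      have h4 := (isDecomp_unique b hJ h2 (hproj p.1 (hmem p List.mem_cons_self).1)).1
      rw [List.map_cons, ← ih fun r hr => hmem r (List.mem_cons_of_mem _ hr), h3, ← h4]
  have hΦ (η : SiLS b lam) : merge (η.1.map fun p => (proj p.1, p.2)) ∈ QLS b (cl lam) := by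
    refine isLSPath_merge_map proj (fun x hx => ?_) hQC η.2
    rw [← Jaf_eq]
    exact (hproj x hx).1
  have hup (a : ℚ) (w w' x) (hx : ∃ ξ, IsDecomp b (Jaf b lam) x w ξ)
      (hQ : QChain b (cl lam) a w w') :
      ∃ x', (∃ ξ, IsDecomp b (Jaf b lam) x' w' ξ) ∧ SiChain b lam a x x' := by
    induction hQ with
    | refl => exact ⟨x, hx, Relation.ReflTransGen.refl⟩
    | tail _ hE ih =>
      obtain ⟨x', ⟨ξ, hx'⟩, hC⟩ := ih
      obtain ⟨γ, hE, k, hk⟩ := hE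
      rw [← Jaf_eq] at hE
      obtain ⟨y, ζ, δ, n, h1, h2, h3⟩ := exists_siEdge_of_qEdge b hJ hE hx' h0 hlam0
      exact ⟨y, ⟨ζ, h2⟩, hC.tail ⟨δ, n, h1, k, by rw [h3]; exact hk⟩⟩
  have hlift (ζ : QLS b (cl lam)) : ∃ η : SiLS b lam, Forgets b lam η.1 ζ.1 := by
    obtain ⟨η, h1, h2⟩ := exists_lift_isLSPath
      (R := fun x w => ∃ ξ, IsDecomp b (Jaf b lam) x w ξ) (S := Pet b (Jaf b lam))
      (C := SiChain b lam)
      (fun x w w' ⟨_, h⟩ ⟨_, h'⟩ => (isDecomp_unique b hJ h h').1)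
      (fun x w ⟨_, h⟩ => mem_Pet_of_isDecomp b hJ h)
      (fun w hw => ⟨w, 0, isDecomp_self b hJ (by rwa [Jaf_eq])⟩) hup ζ.2
    exact ⟨⟨η, h1⟩, h2⟩
  have hlast (ζ : QLS b (cl lam)) :
      ∃ η, Forgets b lam η.1 ζ.1 ∧ (⟨_, hΦ η⟩ : QLS b (cl lam)) = ζ := by
    obtain ⟨η, hη⟩ := hlift ζ
    refine ⟨η, hη, Subtype.ext ?_⟩
    change merge _ = ζ.1
    rw [← hmap η ζ.1 hη]
    -- Consecutive entries of a QLS path are distinct, so nothing is deleted from the image of its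
    -- lift.
    exact merge_eq_self (ζ.2.2.2.imp fun p q h => h.2.1)
  refine ⟨fun x hx => ⟨(proj x, wt x), hproj x hx, fun p hp => ?_⟩,
    fun η => ⟨_, hΦ η⟩, fun η ζ h => ?_, fun ζ => ?_, hlast⟩
  · obtain ⟨h1, h2⟩ := isDecomp_unique b hJ hp (hproj x hx)
    exact Prod.ext h1 h2
  · rw [hmap η ζ h]
  · obtain ⟨η, -, h⟩ := hlast ζ
    exact ⟨η, h⟩
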